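/- A \emph{quad-graph} is a connected graph embedded in the plane all of whose faces, except for holes (the outer face of a finite graph counts as a hole), have degree 4; these faces are the \emph{quads}. It is \emph{simply connected} if the complex formed by its vertices, edges and quads is simply connected (for a finite quad-graph: if the outer face is the only hole). A \emph{strip} (or curve) is a maximal path of quads that leaves each quad through the edge opposite to the one through which it enters; it is identified with the set of edges it crosses, and these edges are dual to the pieces of the curve. A \emph{rhombic embedding} is an embedding of the quad-graph in the plane, carrying quads to bounded faces, such that all edges are line segments of length 1. \emph{Construction method.} Start with one vertex as the only initial and the only known vertex. A piece is \emph{green} if both vertices of its edge are known. In each further step choose an edge joining a known vertex to an unknown vertex (an enclosing piece) whose strip has no green piece (i.e. the piece is orange), add its unknown vertex to the initial and to the known vertices, and then exhaustively apply the rule that three known vertices of a quad make the fourth known. At any stage, a curve $C_0$ \emph{exits} the known subgraph at a quad if an edge of $C_0$ in that quad has two known vertices and the other two vertices of the quad are unknown; the other two edges of that quad form the pair of enclosing pieces at this exit, and lie on one curve $C_1$. Tracking $C_1$ back from this pair $P_1$ over non-green pieces, one may reach an exit of $C_1$, with pair $P_2$ on a curve $C_2$, and so on. If $P_{j+1}=P_1$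 for some $j\ge1$, then $\{C_1,\dots,C_j\}$ is \emph{entangled}. \emph{Relations.} Let $k$ be an infinite field. On each quad let an irreducible polynomial over $k$ in four variables be given, of degree 1 in each of them; a solution is an assignment of values in $k$ to the vertices such that on each quad the polynomial vanishes at the values at its vertices. An initial value problem on a set $I$ of vertices is \emph{well-posed} if for generic initial values on $I$ (outside the zero set of some nonzero polynomial) there is exactly one solution with these values. \textbf{Theorem.} Let $G$ be a simply connected quad-graph that has a rhombic embedding. Then 1. no strip crosses itself, no strip is closed, and two distinct strips cross at most once; 2. no entangled set of curves occurs at any stage of the construction method, whatever choices are made; 3. if $G$ is finite and has $s$ strips (an edge that lies on no quad counting as a strip of its own), then, whatever choices are made, the method never uses more than $s+1$ initial vertices, it can be continued as long as there are fewer than $s+1$ of them, and when there are $s+1$ of them all vertices of $G$ are known and the initial value problem on the initial vertices is well-posed for every such choice of relations. -/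

import Mathlib

universe u v w

/-- A quad-graph, possibly with holes, as a combinatorial map: the faces of a connected graph
embedded in an oriented surface. `V` is the set of vertices and `D` the set of darts (oriented
edges); multiple edges are allowed. A dart `d` runs from `src d` to `src (rev d)` and lies on the
face to its left; `next d` is the dart that follows `d` on the boundary of that face. The faces are
the cycles of `next`, and every face that is not a hole has degree 4. -/
structure QuadGraph (V : Type u) (D : Type v) where
  /-- the same edge with the opposite orientation -/
  rev : Equiv.Perm D
  /-- the next dart along the boundary of the face to the left -/
  next : Equiv.Perm D
  /-- the initial vertex of a dart -/
  src : D → V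
  /-- the darts whose left face is a hole (the outer face of a finite graph is a hole) -/
  hole : Set D
  rev_rev : ∀ d, rev (rev d) = d
  rev_ne : ∀ d, rev d ≠ d
  src_next : ∀ d, src (next d) = src (rev d)
  /-- `next * rev` rotates the darts that leave a vertex; all of them form one cycle -/
  rotation : ∀ d e, src d = src e → (next * rev).SameCycle d e
  hole_next : ∀ d, next d ∈ hole ↔ d ∈ hole
  quad_degree : ∀ d, d ∉ hole → Function.minimalPeriod next d = 4
  hole_degree : ∀ d, d ∈ hole → next d ≠ d
  outer_hole : Finite D → Nonempty D → hole.Nonempty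
  nonempty : Nonempty V
  connected : ∀ x y : V, Relation.ReflTransGen (fun a b => ∃ d, src d = a ∧ src (rev d) = b) x y

namespace QuadGraph

variable {V : Type u} {D : Type v} (G : QuadGraph V D)

/-! ### Simple connectedness -/

/-- The list of darts `l` is a walk from `x` to `y`. -/
def IsWalk : V → List D → V → Prop
  | x, [], y => x = y
  | x, d :: l, y => G.src d = x ∧ IsWalk (G.src (G.rev d)) l y

/-- Elementary contractions of a walk: deleting a backtrack, or the boundary of a quad. -/
inductive Contraction : List D → List D → Prop
  | backtrack (l₁ l₂ : List D) (d : D) :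
      Contraction (l₁ ++ d :: G.rev d :: l₂) (l₁ ++ l₂)
  | quad (l₁ l₂ : List D) (d : D) (hd : d ∉ G.hole) :
      Contraction
        (l₁ ++ d :: G.next d :: G.next (G.next d) :: G.next (G.next (G.next d)) :: l₂) (l₁ ++ l₂)

/-- The 2-complex formed by the vertices, the edges and the quads is simply connected: each closed
walk is homotopic to the constant one. For a finite quad-graph this says that it is planar and that
the outer face is the only hole. -/
def SimplyConnected : Prop :=
  ∀ (x : V) (l : List D), G.IsWalk x l x →
    Relation.EqvGen (fun m m' => G.IsWalk x m x ∧ G.Contraction m m') l []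

/-! ### Strips -/

/-- Two darts are equivalent if one gets from one to the other by reversing orientations and by
passing to the opposite edge of a quad. -/
def stripSetoid : Setoid D :=
  Relation.EqvGen.setoid
    (fun d e => e = G.rev d ∨ (d ∉ G.hole ∧ e = G.next (G.next d)))

/-- A strip (or curve), given by the set of edges that it crosses (its pieces). -/
def Strip : Type v := Quotient G.stripSetoid

/-- The strip through an edge. -/
def strip (d : D) : G.Strip := Quotient.mk G.stripSetoid d

/-- The faces of the graph. -/
def Face : Type v := Quotient (Equiv.Perm.SameCycle.setoid G.next)

/-- The face to the left of a dart. -/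
def face (d : D) : G.Face := Quotient.mk (Equiv.Perm.SameCycle.setoid G.next) d

/-- The quads at which the strips `S` and `T` cross. -/
def crossings (S T : G.Strip) : Set G.Face :=
  {q | ∃ d, d ∉ G.hole ∧ G.face d = q ∧ G.strip d = S ∧ G.strip (G.next d) = T}

/-- Traverse the quad on the left of `d`: the result is the opposite edge, seen from the face
behind it. -/
def across (d : D) : D := G.rev (G.next (G.next d))

/-- A strip is closed if following it through quads one returns to where one started. -/
def IsClosedStrip (S : G.Strip) : Prop :=
  ∃ (d : D) (n : ℕ), G.strip d = S ∧ 0 < n ∧ (∀ k < n, G.across^[k] d ∉ G.hole) ∧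
    G.across^[n] d = d

/-! ### Rhombic embeddings -/

/-- The four corners of the quad to the left of `d`. -/
def corners (d : D) : Set V :=
  {G.src d, G.src (G.next d), G.src (G.next (G.next d)), G.src (G.next (G.next (G.next d)))}

/-- A rhombic embedding in the plane `ℂ`: vertices are mapped injectively, edges to segments of
length 1 that meet only in common end points, and each quad to a (counterclockwise) rhombus that
is a face, that is, whose interior meets no edge. -/
structure RhombicEmbedding where
  pos : V → ℂ
  pos_injective : Function.Injective pos
  length_eq_one : ∀ d, dist (pos (G.src d)) (pos (G.src (G.rev d))) = 1
  edges_disjoint : ∀ d e, e ≠ d → e ≠ G.rev d →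
    segment ℝ (pos (G.src d)) (pos (G.src (G.rev d))) ∩
        segment ℝ (pos (G.src e)) (pos (G.src (G.rev e))) ⊆
      pos '' ({G.src d, G.src (G.rev d)} ∩ {G.src e, G.src (G.rev e)})
  quad_interior : ∀ d, d ∉ G.hole → ∀ e,
    Disjoint (interior (convexHull ℝ (pos '' G.corners d)))
      (segment ℝ (pos (G.src e)) (pos (G.src (G.rev e))))
  quad_counterclockwise : ∀ d, d ∉ G.hole →
    0 < ((starRingEnd ℂ) (pos (G.src (G.next d)) - pos (G.src d)) *
      (pos (G.src (G.next (G.next d))) - pos (G.src (G.next d)))).im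

/-! ### The construction method

A state of the construction is the set `K` of vertices whose values are known; the vertices in `K`
span the subgraph constructed so far. -/

/-- An edge (a piece of a curve) is green if both its vertices are known. -/
def Green (K : Set V) (d : D) : Prop := G.src d ∈ K ∧ G.src (G.rev d) ∈ K

/-- The vertices determined by those in `K`, by exhaustive use of the rule that three known
vertices of a quad determine the fourth. -/
inductive Determined (K : Set V) : V → Prop
  | known {x : V} (hx : x ∈ K) : Determined K x
  | fourth (d : D) (hd : d ∉ G.hole) (h₀ : Determined K (G.src d))
      (h₁ : Determined K (G.src (G.next d))) (h₂ : Determined K (G.src (G.next (G.next d)))) :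
      Determined K (G.src (G.next (G.next (G.next d))))

/-- `d` leads from a known to an unknown vertex (it is a piece of the enclosure), and no piece of
the curve through it is green. -/
def IsOrangeEnclosing (K : Set V) (d : D) : Prop :=
  G.src d ∈ K ∧ G.src (G.rev d) ∉ K ∧ ∀ e, G.strip e = G.strip d → ¬ G.Green K e

/-- `Run I K`: the construction method can arrive at the initial value problem posed on the
vertices in `I`, with known vertices `K`. One starts with a single vertex. In each further step one
colours an orange enclosing piece green, which adds its unknown vertex to the initial values, and
then propagates exhaustively. -/
inductive Run : Set V → Set V → Prop
  | start (x : V) : Run {x} {x}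
  | step {I K : Set V} (d : D) (h : Run I K) (hd : G.IsOrangeEnclosing K d) :
      Run (insert (G.src (G.rev d)) I)
        {y | G.Determined (insert (G.src (G.rev d)) K) y}

/-- At the quad to the left of `d`, the curve through `d` leaves the known subgraph through a pair
of enclosing pieces, namely the edges `next d` and `next (next (next d))` of that quad. -/
def IsExit (K : Set V) (d : D) : Prop :=
  d ∉ G.hole ∧ G.Green K d ∧ G.src (G.next (G.next d)) ∉ K ∧
    G.src (G.next (G.next (G.next d))) ∉ K

/-- If one starts at the pair of enclosing pieces at the exit `p` and follows the curve through
these pieces over non-green pieces back to where it crosses the boundary of the known subgraph, one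
arrives at the exit `p'`. (In particular, the pair at `p` is red: its curve is partly green.) -/
def TracksBack (K : Set V) (p p' : D) : Prop :=
  G.IsExit K p' ∧ ∃ n : ℕ, 1 ≤ n ∧
    (G.across^[n] p' = G.next p ∨ G.across^[n] p' = G.next (G.next (G.next p))) ∧
    ∀ k, 1 ≤ k → k ≤ n → G.across^[k] p' ∉ G.hole ∧ ¬ G.Green K (G.across^[k] p')

/-- `A` is an entangled set of curves leaving the known subgraph: the curves of `A` are those of
the pairs of red enclosing pieces at exits `p 0`, `p 1`, …, `p n`, where `p (i + 1)` is found from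
`p i` by tracking back, and where one returns to `p n = p 0`. -/
def IsEntangled (K : Set V) (A : Set G.Strip) : Prop :=
  ∃ (n : ℕ) (p : ℕ → D), 0 < n ∧ p n = p 0 ∧ G.IsExit K (p 0) ∧
    (∀ i < n, G.TracksBack K (p i) (p (i + 1))) ∧
    A = {S | ∃ i < n, S = G.strip (G.next (p i))}

/-! ### Initial value problems -/

/-- Non-degenerate multi-affine relations on the quads, with values in the field `k`: on each quad
an irreducible polynomial in the values at its four vertices (and depending on all of them), of
degree 1 in each. -/
structure Relations (k : Type w) [Field k] where
  rel : D → MvPolynomial V k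
  rel_next : ∀ d, d ∉ G.hole → rel (G.next d) = rel d
  vars_rel : ∀ d, d ∉ G.hole → ((rel d).vars : Set V) = G.corners d
  degreeOf_rel : ∀ d, d ∉ G.hole → ∀ x ∈ G.corners d, (rel d).degreeOf x = 1
  irreducible_rel : ∀ d, d ∉ G.hole → Irreducible (rel d)

variable {G} in
/-- `f` satisfies the relations on all quads. -/
def Relations.IsSolution {k : Type w} [Field k] (E : G.Relations k) (f : V → k) : Prop :=
  ∀ d, d ∉ G.hole → MvPolynomial.eval f (E.rel d) = 0

variable {G} in
/-- The initial value problem on `I` is well-posed: for generic initial values, that is, outside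
the zero set of some non-zero polynomial, a solution exists and is unique. -/
def Relations.WellPosed {k : Type w} [Field k] (E : G.Relations k) (I : Set V) : Prop :=
  ∃ P : MvPolynomial I k, P ≠ 0 ∧ ∀ a : I → k, MvPolynomial.eval a P ≠ 0 →
    ∃! f : V → k, E.IsSolution f ∧ ∀ i : I, f i = a i

end QuadGraph

/-! In a rhombic embedding opposite sides of a quad are parallel (`vec_next_next`), so a strip
carries a unit vector that is constant up to sign. Crossing a quad moves one strictly to the left of
this vector; hence no strip is closed, and none crosses itself, as adjacent sides are not parallel.
Simple connectedness makes the signed number of crossings with a strip `T` a function on the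
vertices. Along another strip `S` all crossings with `T` have the same sign, because it is fixed by
the two vectors, whereas this function is constant along each side of `T`. So `S` meets `T` only
once (`strip_next_iterate_ne`).

From then on only `IsArrangement` is used: strips separate the vertices and meet like pseudolines. A
walk that crosses no strip twice crosses exactly the strips that separate its ends. The known set is
always connected and closed under the quad rule, and such a set contains all geodesics between its
points (`walkIn_of_isGeodesic`, `exists_isGeodesic_walkIn`). Consequently a strip with a green piece
has no enclosing piece (`IsConvex.tgt_mem`): every enclosing piece is orange, nothing can be tracked
back to an exit, and the method stops only when all vertices are known. Each step makes exactly one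
more strip green (`greenStrips_closure_insert`), so the number of initial vertices is one more than
the number of green strips.

For well-posedness, algebraically independent initial values are extended to a solution for which
any three values on a quad are independent (`exists_isGenericOn`), by induction on the number of
known vertices. A step from `K` to `W` adds the part of `W` beyond the new strip. The new initial
value is transcendental over all values on `K`, so the solution extends quad by quad along the
strip. An exchange argument in the matroid of algebraic independence makes the values on the far
side of the strip independent, and the vertices there are initial vertices for `W \ K`
(`run_sdiff`), so that induction applies again. The same exchange argument allows one set of initial
vertices to be replaced by any other. Finally the solution in rational functions is specialized
(`exists_specialization`), and uniqueness holds where the coefficients that determine the fourth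
value on each quad do not vanish. -/

namespace QuadGraph

variable {V : Type u} {D : Type v} {G : QuadGraph V D}

/-! ### Darts, walks and strips -/

variable (G) in
/-- The final vertex of a dart. -/
def tgt (d : D) : V := G.src (G.rev d)

lemma src_rev (d : D) : G.src (G.rev d) = G.tgt d := rfl

lemma tgt_rev (d : D) : G.tgt (G.rev d) = G.src d := by rw [tgt, G.rev_rev]

lemma src_next_eq (d : D) : G.src (G.next d) = G.tgt d := G.src_next d

lemma next_notMem {d : D} (hd : d ∉ G.hole) : G.next d ∉ G.hole := fun h =>
  hd ((G.hole_next d).1 h)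

lemma next_four {d : D} (hd : d ∉ G.hole) : G.next (G.next (G.next (G.next d))) = d := by
  have h := Function.isPeriodicPt_minimalPeriod G.next d
  rw [G.quad_degree d hd] at h
  exact h

lemma tgt_next_three {d : D} (hd : d ∉ G.hole) :
    G.tgt (G.next (G.next (G.next d))) = G.src d := by
  rw [← src_next_eq, next_four hd]

lemma strip_rev (d : D) : G.strip (G.rev d) = G.strip d :=
  Quotient.sound (Relation.EqvGen.symm _ _ (Relation.EqvGen.rel _ _ (Or.inl rfl)))

lemma strip_next_next {d : D} (hd : d ∉ G.hole) : G.strip (G.next (G.next d)) = G.strip d :=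
  Quotient.sound (Relation.EqvGen.symm _ _ (Relation.EqvGen.rel _ _ (Or.inr ⟨hd, rfl⟩)))

lemma strip_across {d : D} (hd : d ∉ G.hole) : G.strip (G.across d) = G.strip d := by
  rw [across, strip_rev, strip_next_next hd]

lemma strip_next_three {d : D} (hd : d ∉ G.hole) :
    G.strip (G.next (G.next (G.next d))) = G.strip (G.next d) :=
  strip_next_next (next_notMem hd)

lemma src_across (d : D) : G.src (G.across d) = G.src (G.next (G.next (G.next d))) := by
  rw [across, src_rev, ← src_next_eq]

lemma tgt_across (d : D) : G.tgt (G.across d) = G.src (G.next (G.next d)) := by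
  rw [across, tgt_rev]

lemma isWalk_append {x y : V} {l m : List D} :
    G.IsWalk x (l ++ m) y ↔ ∃ z, G.IsWalk x l z ∧ G.IsWalk z m y := by
  induction l generalizing x with
  | nil => simp [IsWalk]
  | cons d l ih => simp [IsWalk, ih, and_assoc]

lemma isWalk_singleton (d : D) : G.IsWalk (G.src d) [d] (G.tgt d) := ⟨rfl, rfl⟩

lemma IsWalk.reverse {x y : V} {l : List D} (h : G.IsWalk x l y) :
    G.IsWalk y (l.map G.rev).reverse x := by
  induction l generalizing x with
  | nil => exact Eq.symm h
  | cons d l ih =>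
    rw [List.map_cons, List.reverse_cons, isWalk_append]
    exact ⟨_, ih h.2, rfl, (tgt_rev d).trans h.1⟩

variable (G) in
lemma exists_isWalk (x y : V) : ∃ l, G.IsWalk x l y := by
  induction G.connected x y with
  | refl => exact ⟨[], rfl⟩
  | tail _ h ih =>
    obtain ⟨l, hl⟩ := ih
    obtain ⟨d, rfl, rfl⟩ := h
    exact ⟨l ++ [d], isWalk_append.2 ⟨_, hl, isWalk_singleton d⟩⟩

/-! ### Cocycles have potentials -/

variable (G) in
/-- A function on the darts that changes its sign when an edge is reversed and when one passes to
the opposite dart on the boundary of a quad. -/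
structure IsCocycle {A : Type*} [AddCommGroup A] (φ : D → A) : Prop where
  map_rev : ∀ d, φ (G.rev d) = -φ d
  map_opposite : ∀ d, d ∉ G.hole → φ (G.next (G.next d)) = -φ d

namespace IsCocycle

variable {A : Type*} [AddCommGroup A] {φ : D → A}

lemma sum_eq_of_contraction (hφ : G.IsCocycle φ) {l m : List D} (h : G.Contraction l m) :
    (l.map φ).sum = (m.map φ).sum := by
  cases h with
  | backtrack l₁ l₂ d => simp [hφ.map_rev]
  | quad l₁ l₂ d hd =>
    simp only [List.map_append, List.map_cons, List.sum_append, List.sum_cons,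
      hφ.map_opposite d hd, hφ.map_opposite _ (next_notMem hd)]
    abel

lemma sum_eq_zero (hφ : G.IsCocycle φ) (hG : G.SimplyConnected) {x : V} {l : List D}
    (h : G.IsWalk x l x) : (l.map φ).sum = 0 := by
  have key : ∀ m m' : List D, Relation.EqvGen
      (fun m m' => G.IsWalk x m x ∧ G.Contraction m m') m m' →
      (m.map φ).sum = (m'.map φ).sum := by
    intro m m' hm
    induction hm with
    | rel _ _ h => exact hφ.sum_eq_of_contraction h.2
    | refl => rfl
    | symm _ _ _ ih => exact ih.symm
    | trans _ _ _ _ _ ih₁ ih₂ => exact ih₁.trans ih₂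
  simpa using key _ _ (hG x l h)

/-- The sum of a cocycle along a walk is unchanged by contractions, so it depends only on the end
points. The potential is the sum along a chosen walk from a base vertex. -/
lemma exists_potential (hφ : G.IsCocycle φ) (hG : G.SimplyConnected) :
    ∃ h : V → A, ∀ d, h (G.tgt d) = h (G.src d) + φ d := by
  obtain ⟨o⟩ := G.nonempty
  choose w hw using G.exists_isWalk o
  refine ⟨fun x => ((w x).map φ).sum, fun d => ?_⟩
  have hc : G.IsWalk o (w (G.src d) ++ d :: ((w (G.tgt d)).map G.rev).reverse) o :=
    isWalk_append.2 ⟨_, hw _, rfl, (hw (G.tgt d)).reverse⟩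
  have h0 := hφ.sum_eq_zero hG hc
  have hr : ∀ l : List D, ((l.map G.rev).map φ).sum = -(l.map φ).sum := by
    intro l
    induction l with
    | nil => simp
    | cons a l ih => simp only [List.map_cons, List.sum_cons, ih, hφ.map_rev]; abel
  rw [List.map_append, List.sum_append, List.map_cons, List.sum_cons, List.map_reverse,
    List.sum_reverse, hr, ← add_assoc, add_neg_eq_zero] at h0
  exact h0.symm

end IsCocycle

/-! ### Moving along a strip -/

variable (G) in
/-- One arrives at `e` if one crosses `n` quads along the strip through `d`. -/
def Reach (n : ℕ) (d e : D) : Prop := (∀ k < n, G.across^[k] d ∉ G.hole) ∧ G.across^[n] d = e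

lemma rev_across_notMem {d : D} (hd : d ∉ G.hole) : G.rev (G.across d) ∉ G.hole := by
  rw [across, G.rev_rev]
  exact next_notMem (next_notMem hd)

lemma across_rev_across {d : D} (hd : d ∉ G.hole) : G.across (G.rev (G.across d)) = G.rev d := by
  rw [across, across, G.rev_rev, next_four hd]

lemma reach_zero (d : D) : G.Reach 0 d d := ⟨fun k hk => absurd hk (Nat.not_lt_zero k), rfl⟩

lemma reach_one {d : D} (hd : d ∉ G.hole) : G.Reach 1 d (G.across d) :=
  ⟨fun k hk => by obtain rfl : k = 0 := by omega
                  exact hd, rfl⟩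

lemma Reach.trans {m n : ℕ} {d e f : D} (h : G.Reach m d e) (h' : G.Reach n e f) :
    G.Reach (m + n) d f := by
  obtain ⟨h1, rfl⟩ := h
  obtain ⟨h2, rfl⟩ := h'
  refine ⟨fun k hk => ?_, by rw [Nat.add_comm, Function.iterate_add_apply]⟩
  by_cases hkm : k < m
  · exact h1 k hkm
  · have := h2 (k - m) (by omega)
    rwa [← Function.iterate_add_apply, Nat.sub_add_cancel (by omega)] at this

lemma Reach.split {m n : ℕ} {d e : D} (h : G.Reach (m + n) d e) :
    G.Reach m d (G.across^[m] d) ∧ G.Reach n (G.across^[m] d) e := by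
  refine ⟨⟨fun k hk => h.1 k (by omega), rfl⟩, fun k hk => ?_, ?_⟩
  · rw [← Function.iterate_add_apply]
    exact h.1 _ (by omega)
  · rw [← Function.iterate_add_apply, Nat.add_comm]
    exact h.2

lemma Reach.reverse {n : ℕ} {d e : D} (h : G.Reach n d e) : G.Reach n (G.rev e) (G.rev d) := by
  induction n generalizing e with
  | zero =>
    obtain ⟨-, rfl⟩ := h
    exact reach_zero _
  | succ n ih =>
    obtain ⟨h1, h2⟩ := h.split
    have hd : G.across^[n] d ∉ G.hole := h2.1 0 one_pos
    obtain rfl : G.across (G.across^[n] d) = e := h2.2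
    have h3 := reach_one (rev_across_notMem hd)
    rw [across_rev_across hd] at h3
    rw [Nat.add_comm]
    exact h3.trans (ih h1)

lemma Reach.left_cancel {m n : ℕ} {d e f : D} (h : G.Reach m d e) (h' : G.Reach n d f)
    (hmn : m ≤ n) : G.Reach (n - m) e f := by
  obtain ⟨k, rfl⟩ := Nat.exists_eq_add_of_le hmn
  rw [Nat.add_sub_cancel_left, ← h.2]
  exact h'.split.2

variable (G) in
/-- `d` and `e` lie on the same strip and have the same orientation. -/
def Aligned (d e : D) : Prop := ∃ n, G.Reach n d e ∨ G.Reach n e d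

lemma Aligned.refl (d : D) : G.Aligned d d := ⟨0, Or.inl (reach_zero d)⟩

lemma Aligned.symm {d e : D} : G.Aligned d e → G.Aligned e d := fun ⟨n, h⟩ => ⟨n, h.symm⟩

lemma Aligned.rev {d e : D} : G.Aligned d e → G.Aligned (G.rev d) (G.rev e) := fun ⟨n, h⟩ =>
  ⟨n, h.symm.imp Reach.reverse Reach.reverse⟩

/-- Since `across` is a function, of two darts reached from the same dart one is reached from the
other. After reversal this also covers two darts that reach a common one, whence transitivity. -/
lemma aligned_of_reach {m n : ℕ} {d e f : D} (h : G.Reach m d e) (h' : G.Reach n d f) :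
    G.Aligned e f := by
  rcases le_total m n with hmn | hmn
  · exact ⟨_, Or.inl (h.left_cancel h' hmn)⟩
  · exact ⟨_, Or.inr (h'.left_cancel h hmn)⟩

lemma Aligned.trans {d e f : D} (h : G.Aligned d e) (h' : G.Aligned e f) : G.Aligned d f := by
  obtain ⟨m, h | h⟩ := h <;> obtain ⟨n, h' | h'⟩ := h'
  · exact ⟨_, Or.inl (h.trans h')⟩
  · have := (aligned_of_reach h.reverse h'.reverse).rev
    rwa [G.rev_rev, G.rev_rev] at this
  · exact aligned_of_reach h h'
  · exact ⟨_, Or.inr (h'.trans h)⟩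

lemma aligned_across {d : D} (hd : d ∉ G.hole) : G.Aligned d (G.across d) :=
  ⟨1, Or.inl (reach_one hd)⟩

/-- The generated equivalence relation is made explicit: a strip is a single line, and up to
orientation any two of its darts are joined by crossing quads in one direction. -/
lemma aligned_or_aligned_rev {d e : D} (h : G.strip d = G.strip e) :
    G.Aligned d e ∨ G.Aligned d (G.rev e) := by
  have h' : Relation.EqvGen
    (fun d e => e = G.rev d ∨ (d ∉ G.hole ∧ e = G.next (G.next d))) d e := Quotient.exact h
  clear h
  induction h' with
  | rel d e h =>
    rcases h with rfl | ⟨hd, rfl⟩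
    · rw [G.rev_rev]; exact Or.inr (Aligned.refl d)
    · exact Or.inr (aligned_across hd)
  | refl d => exact Or.inl (Aligned.refl d)
  | symm d e _ ih =>
    rcases ih with ih | ih
    · exact Or.inl ih.symm
    · have := ih.symm.rev
      rw [G.rev_rev] at this
      exact Or.inr this
  | trans d e f _ _ ih1 ih2 =>
    rcases ih1 with i1 | i1 <;> rcases ih2 with i2 | i2
    · exact Or.inl (i1.trans i2)
    · exact Or.inr (i1.trans i2)
    · exact Or.inr (i1.trans i2.rev)
    · have := i2.rev
      rw [G.rev_rev] at this
      exact Or.inl (i1.trans this)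

lemma Reach.strip_eq {n : ℕ} {d e : D} (h : G.Reach n d e) : G.strip e = G.strip d := by
  induction n generalizing e with
  | zero =>
    obtain ⟨-, rfl⟩ := h
    rfl
  | succ n ih =>
    obtain ⟨h1, h2⟩ := h.split
    obtain rfl : G.across (G.across^[n] d) = e := h2.2
    have hm : G.across^[n] d ∉ G.hole := h2.1 0 one_pos
    rw [strip_across hm, ih h1]

lemma Aligned.strip_eq {d e : D} : G.Aligned d e → G.strip d = G.strip e := by
  rintro ⟨n, h | h⟩
  · exact h.strip_eq.symm
  · exact h.strip_eq

/-! ### Rhombic embeddings -/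

namespace RhombicEmbedding

variable (ρ : G.RhombicEmbedding)

/-- The vector from the initial to the final vertex of a dart. -/
def vec (d : D) : ℂ := ρ.pos (G.tgt d) - ρ.pos (G.src d)

/-- The area of the parallelogram spanned by two vectors. -/
def cross (z w : ℂ) : ℝ := z.re * w.im - z.im * w.re

lemma cross_neg_right (z w : ℂ) : cross z (-w) = -cross z w := by simp [cross]; ring

lemma cross_self (z : ℂ) : cross z z = 0 := by simp [cross]; ring

lemma vec_rev (d : D) : ρ.vec (G.rev d) = -ρ.vec d := by
  rw [vec, vec, tgt_rev, src_rev, neg_sub]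

lemma cross_vec_next_pos {d : D} (hd : d ∉ G.hole) :
    0 < cross (ρ.vec d) (ρ.vec (G.next d)) := by
  have h := ρ.quad_counterclockwise d hd
  rw [src_next_eq, src_next_eq] at h
  simp only [cross, vec, src_next_eq]
  simp only [Complex.mul_im, Complex.conj_re, Complex.conj_im] at h
  linarith

lemma norm_vec (d : D) : ‖ρ.vec d‖ = 1 := by
  rw [vec, ← dist_eq_norm, dist_comm]
  exact ρ.length_eq_one d

/-- Let `a`, `b`, `c` be three consecutive sides. As `a`, `b`, `c` and `a + b + c` are unit vectors,
the sums `a + b`, `b + c`, `c + a` are pairwise orthogonal, so in the plane one of them is zero. It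
is the last one, since consecutive sides are not parallel. -/
lemma vec_next_next {d : D} (hd : d ∉ G.hole) : ρ.vec (G.next (G.next d)) = -ρ.vec d := by
  have n0 := ρ.norm_vec d
  have n1 := ρ.norm_vec (G.next d)
  have n2 := ρ.norm_vec (G.next (G.next d))
  have n3 := ρ.norm_vec (G.next (G.next (G.next d)))
  have c0 := ρ.cross_vec_next_pos hd
  have c1 := ρ.cross_vec_next_pos (next_notMem hd)
  have hs : ρ.vec d + ρ.vec (G.next d) + ρ.vec (G.next (G.next d)) +
      ρ.vec (G.next (G.next (G.next d))) = 0 := by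
    simp only [vec, src_next_eq, tgt_next_three hd]
    ring
  obtain ⟨a, ha⟩ : ∃ a, a = ρ.vec d := ⟨_, rfl⟩
  obtain ⟨b, hb⟩ : ∃ a, a = ρ.vec (G.next d) := ⟨_, rfl⟩
  obtain ⟨c, hc⟩ : ∃ a, a = ρ.vec (G.next (G.next d)) := ⟨_, rfl⟩
  rw [← ha] at n0 c0 hs ⊢
  rw [← hb] at n1 c0 c1 hs
  rw [← hc] at n2 c1 hs ⊢
  have e3 : ρ.vec (G.next (G.next (G.next d))) = -(a + b + c) := by
    linear_combination hs
  rw [e3, norm_neg] at n3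
  have key : ∀ z : ℂ, ‖z‖ = 1 → z.re * z.re + z.im * z.im = 1 := by
    intro z hz
    rw [← Complex.normSq_apply, Complex.normSq_eq_norm_sq, hz, one_pow]
  have k0 := key _ n0
  have k1 := key _ n1
  have k2 := key _ n2
  have k3 := key _ n3
  simp only [Complex.add_re, Complex.add_im] at k3
  simp only [cross] at c0 c1
  obtain ⟨p, hp⟩ : ∃ p, p = a + b := ⟨_, rfl⟩
  obtain ⟨q, hq⟩ : ∃ q, q = b + c := ⟨_, rfl⟩
  obtain ⟨r, hr⟩ : ∃ r, r = c + a := ⟨_, rfl⟩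
  have pq : p.re * q.re + p.im * q.im = 0 := by
    simp only [hp, hq, Complex.add_re, Complex.add_im]; linarith
  have pr : p.re * r.re + p.im * r.im = 0 := by
    simp only [hp, hr, Complex.add_re, Complex.add_im]; linarith
  have qr : q.re * r.re + q.im * r.im = 0 := by
    simp only [hq, hr, Complex.add_re, Complex.add_im]; linarith
  have hp0 : cross a p ≠ 0 := by
    have : cross a p = cross a b := by simp [hp, cross]; ring
    rw [this]; exact c0.ne'
  have hq0 : cross b q ≠ 0 := by
    have : cross b q = cross b c := by simp [hq, cross]; ring
    rw [this]; exact c1.ne'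
  -- If `q` and `r` were linearly independent, then `p`, orthogonal to both, would vanish.
  have hqr : q.re * r.im - q.im * r.re = 0 := by
    by_contra hne
    have h1 : (q.re * r.im - q.im * r.re) * p.re = 0 := by
      linear_combination r.im * pq - q.im * pr
    have h2 : (q.re * r.im - q.im * r.re) * p.im = 0 := by
      linear_combination q.re * pr - r.re * pq
    apply hp0
    simp [cross, (mul_eq_zero.1 h1).resolve_left hne, (mul_eq_zero.1 h2).resolve_left hne]
  -- Now `q` is both parallel and orthogonal to `r`, so `r ≠ 0` would force `q = 0`.
  have hr0 : r = 0 := by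
    by_contra hne
    apply hq0
    have hrn : r.re * r.re + r.im * r.im ≠ 0 := by
      rw [← Complex.normSq_apply]
      exact fun h => hne (Complex.normSq_eq_zero.1 h)
    have h1 : (r.re * r.re + r.im * r.im) * q.re = 0 := by
      linear_combination r.re * qr + r.im * hqr
    have h2 : (r.re * r.re + r.im * r.im) * q.im = 0 := by
      linear_combination r.im * qr - r.re * hqr
    simp [cross, (mul_eq_zero.1 h1).resolve_left hrn, (mul_eq_zero.1 h2).resolve_left hrn]
  rw [hr] at hr0
  exact eq_neg_of_add_eq_zero_left hr0

lemma vec_across {d : D} (hd : d ∉ G.hole) : ρ.vec (G.across d) = ρ.vec d := by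
  rw [across, vec_rev, ρ.vec_next_next hd, neg_neg]

lemma vec_eq_of_reach {n : ℕ} {d e : D} (h : G.Reach n d e) : ρ.vec e = ρ.vec d := by
  induction n generalizing e with
  | zero =>
    obtain ⟨-, rfl⟩ := h
    rfl
  | succ n ih =>
    obtain ⟨h1, h2⟩ := h.split
    obtain rfl : G.across (G.across^[n] d) = e := h2.2
    have hm : G.across^[n] d ∉ G.hole := h2.1 0 one_pos
    rw [ρ.vec_across hm, ih h1]

lemma vec_eq_of_aligned {d e : D} (h : G.Aligned d e) : ρ.vec e = ρ.vec d := by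
  obtain ⟨n, h | h⟩ := h
  · exact ρ.vec_eq_of_reach h
  · exact (ρ.vec_eq_of_reach h).symm

lemma vec_eq_or_eq_neg {d e : D} (h : G.strip d = G.strip e) :
    ρ.vec e = ρ.vec d ∨ ρ.vec e = -ρ.vec d := by
  rcases aligned_or_aligned_rev h with h | h
  · exact Or.inl (ρ.vec_eq_of_aligned h)
  · have := ρ.vec_eq_of_aligned h
    rw [vec_rev] at this
    exact Or.inr (by rw [← this, neg_neg])

include ρ in
lemma strip_next_ne {d : D} (hd : d ∉ G.hole) : G.strip (G.next d) ≠ G.strip d := by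
  intro h
  have c := ρ.cross_vec_next_pos hd
  rcases ρ.vec_eq_or_eq_neg h.symm with h | h <;> rw [h] at c <;>
    simp [cross_self, cross_neg_right] at c

lemma vec_ne_neg (d : D) : ρ.vec d ≠ -ρ.vec d := by
  intro h
  have h0 : ρ.vec d = 0 := by linear_combination (1 / 2 : ℂ) * h
  have := ρ.norm_vec d
  simp [h0] at this

open Classical in
/-- The algebraic number of times that a dart crosses the strip through `f`. -/
noncomputable def sign (f d : D) : ℤ :=
  if G.strip d = G.strip f then (if ρ.vec d = ρ.vec f then 1 else -1) else 0

lemma isCocycle_sign (f : D) : G.IsCocycle (ρ.sign f) := by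
  have key : ∀ d e, G.strip e = G.strip d → ρ.vec e = -ρ.vec d → ρ.sign f e = -ρ.sign f d := by
    intro d e hs hv
    unfold sign
    rw [hs]
    by_cases h : G.strip d = G.strip f
    · rw [if_pos h, if_pos h, hv]
      have := ρ.vec_ne_neg f
      rcases ρ.vec_eq_or_eq_neg h.symm with h' | h' <;> rw [h']
      · simp [this.symm]
      · simp [this.symm]
    · simp [h]
  exact ⟨fun d => key _ _ (strip_rev d) (ρ.vec_rev d),
    fun d hd => key _ _ (strip_next_next hd) (ρ.vec_next_next hd)⟩

include ρ in
/-- A strip crosses each other strip only once. -/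
lemma strip_next_iterate_ne (hG : G.SimplyConnected) {n : ℕ} (hn : 0 < n) {d e : D}
    (h : G.Reach n d e) (he : e ∉ G.hole) : G.strip (G.next e) ≠ G.strip (G.next d) := by
  intro hs
  have hd : d ∉ G.hole := h.1 0 hn
  obtain ⟨p, hp⟩ := (ρ.isCocycle_sign (G.next d)).exists_potential hG
  -- At every quad along the strip, the next side turns left from the same vector `vec d`. Thus a
  -- side that belongs to the strip of `next d` has the same direction as `next d`, and counts
  -- positively.
  have hnn : ∀ e, e ∉ G.hole → ρ.vec e = ρ.vec d → 0 ≤ ρ.sign (G.next d) (G.next e) := by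
    intro e he hv
    unfold sign
    split_ifs with h1 h2
    · exact zero_le_one
    · rcases ρ.vec_eq_or_eq_neg h1.symm with h3 | h3
      · exact absurd h3 h2
      · have c1 := ρ.cross_vec_next_pos hd
        have c2 := ρ.cross_vec_next_pos he
        rw [h3, hv, cross_neg_right] at c2
        linarith
    · exact le_rfl
  have hstep : ∀ e, p (G.tgt (G.across e)) = p (G.tgt e) + ρ.sign (G.next d) (G.next e) := by
    intro e
    rw [tgt_across, src_next_eq, hp, src_next_eq]
  -- The first quad contributes 1, and the later ones contribute nothing negative.
  have hmono : ∀ m e, G.Reach m d e → 0 < m → p (G.tgt d) + 1 ≤ p (G.tgt e) := by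
    intro m
    induction m with
    | zero => intro e _ h0; exact absurd h0 (lt_irrefl 0)
    | succ m ih =>
      intro e hr _
      obtain ⟨h1, h2⟩ := hr.split
      obtain rfl : G.across (G.across^[m] d) = e := h2.2
      have hm : G.across^[m] d ∉ G.hole := h2.1 0 one_pos
      rw [hstep]
      rcases Nat.eq_zero_or_pos m with rfl | hm0
      · simp [sign]
      · have := ih _ h1 hm0
        have := hnn _ hm (ρ.vec_eq_of_reach h1)
        omega
  have h1 := hmono n e h hn
  -- Along its own side, a strip is never crossed, so the potential is constant there.
  have hlevel : ∀ m f g, G.strip f = G.strip (G.next d) → G.Reach m f g →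
      p (G.src g) = p (G.src f) := by
    intro m f
    induction m with
    | zero =>
      rintro g - ⟨-, rfl⟩
      rfl
    | succ m ih =>
      intro g hf hr
      obtain ⟨h1, h2⟩ := hr.split
      obtain rfl : G.across (G.across^[m] f) = g := h2.2
      have hm : G.across^[m] f ∉ G.hole := h2.1 0 one_pos
      rw [← ih _ hf h1, src_across, ← tgt_next_three hm, hp]
      have : G.strip (G.next (G.next (G.next (G.across^[m] f)))) ≠ G.strip (G.next d) := by
        rw [strip_next_three hm, ← hf, ← h1.strip_eq]
        exact ρ.strip_next_ne hm
      simp [sign, this]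
  -- Opposite orientations would contradict the positive turning at one of the two quads.
  have hal : G.Aligned (G.next d) (G.next e) := by
    rcases aligned_or_aligned_rev hs.symm with h2 | h2
    · exact h2
    · have h3 := ρ.vec_eq_of_aligned h2
      have c1 := ρ.cross_vec_next_pos hd
      have c2 := ρ.cross_vec_next_pos he
      rw [← h3, vec_rev, ← ρ.vec_eq_of_reach h, cross_neg_right] at c1
      linarith
  have h2 : p (G.src (G.next e)) = p (G.src (G.next d)) := by
    obtain ⟨m, h2 | h2⟩ := hal
    · exact hlevel _ _ _ rfl h2
    · exact (hlevel _ _ _ hs h2).symm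
  rw [src_next_eq, src_next_eq] at h2
  omega

include ρ in
lemma not_isClosedStrip (S : G.Strip) : ¬ G.IsClosedStrip S := by
  rintro ⟨d, n, -, hn, hh, hc⟩
  -- The component of the position perpendicular to `vec d` increases strictly with each quad,
  -- because each quad is counterclockwise.
  have key : ∀ m e, G.Reach m d e →
      cross (ρ.vec d) (ρ.pos (G.tgt d)) ≤ cross (ρ.vec d) (ρ.pos (G.tgt e)) ∧
      (0 < m → cross (ρ.vec d) (ρ.pos (G.tgt d)) < cross (ρ.vec d) (ρ.pos (G.tgt e))) := by
    intro m
    induction m with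
    | zero =>
      rintro e ⟨-, rfl⟩
      exact ⟨le_rfl, fun h => absurd h (lt_irrefl 0)⟩
    | succ m ih =>
      intro e hr
      obtain ⟨h1, h2⟩ := hr.split
      obtain rfl : G.across (G.across^[m] d) = e := h2.2
      have hm : G.across^[m] d ∉ G.hole := h2.1 0 one_pos
      have c := ρ.cross_vec_next_pos hm
      rw [ρ.vec_eq_of_reach h1] at c
      have h3 := (ih _ h1).1
      rw [show ρ.vec (G.next (G.across^[m] d)) = ρ.pos (G.tgt (G.next (G.across^[m] d))) -
        ρ.pos (G.src (G.next (G.across^[m] d))) from rfl, src_next_eq] at c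
      rw [tgt_across, src_next_eq]
      have : cross (ρ.vec d) (ρ.pos (G.tgt (G.next (G.across^[m] d)))) =
        cross (ρ.vec d) (ρ.pos (G.tgt (G.across^[m] d))) +
        cross (ρ.vec d) (ρ.pos (G.tgt (G.next (G.across^[m] d))) -
          ρ.pos (G.tgt (G.across^[m] d))) := by
        simp [cross]; ring
      exact ⟨by linarith, fun _ => by linarith⟩
  exact lt_irrefl _ ((key n d ⟨hh, hc⟩).2 hn)

end RhombicEmbedding

/-! ### Strips as an arrangement of curves -/

variable (G) in
/-- Each strip separates the vertices into two sides, no strip crosses itself, and no strip meets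
another one twice. -/
structure IsArrangement : Prop where
  exists_side : ∀ T : G.Strip, ∃ s : V → ZMod 2, ∀ d,
    (G.strip d = T → s (G.tgt d) ≠ s (G.src d)) ∧ (G.strip d ≠ T → s (G.tgt d) = s (G.src d))
  strip_next_ne : ∀ d, d ∉ G.hole → G.strip (G.next d) ≠ G.strip d
  strip_next_reach_ne : ∀ n d e, 0 < n → G.Reach n d e → e ∉ G.hole →
    G.strip (G.next e) ≠ G.strip (G.next d)

-- Modulo 2 the indicator function of a strip is a cocycle without any choice of orientation, since
-- `-1 = 1`. Its potential gives the two sides.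
open Classical in
lemma SimplyConnected.exists_side (hG : G.SimplyConnected) (T : G.Strip) :
    ∃ s : V → ZMod 2, ∀ d,
      (G.strip d = T → s (G.tgt d) ≠ s (G.src d)) ∧
      (G.strip d ≠ T → s (G.tgt d) = s (G.src d)) := by
  have hc : G.IsCocycle (fun d => if G.strip d = T then (1 : ZMod 2) else 0) := by
    constructor
    · intro d
      simp only [strip_rev]
      split_ifs <;> decide
    · intro d hd
      simp only [strip_next_next hd]
      split_ifs <;> decide
  obtain ⟨s, hs⟩ := hc.exists_potential hG
  refine ⟨s, fun d => ⟨fun h => ?_, fun h => ?_⟩⟩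
  · rw [hs, if_pos h]
    generalize s (G.src d) = a
    revert a
    decide
  · rw [hs, if_neg h, add_zero]

lemma RhombicEmbedding.isArrangement (ρ : G.RhombicEmbedding) (hG : G.SimplyConnected) :
    G.IsArrangement :=
  ⟨hG.exists_side, fun _ hd => ρ.strip_next_ne hd,
    fun _ _ _ hn h he => ρ.strip_next_iterate_ne hG hn h he⟩

namespace IsArrangement

variable (hA : G.IsArrangement)
include hA

lemma crossings_self (S : G.Strip) : G.crossings S S = ∅ := by
  ext q
  simp only [crossings, Set.mem_ofPred_eq, Set.mem_empty_iff_false, iff_false]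
  rintro ⟨d, hd, -, h1, h2⟩
  exact hA.strip_next_ne d hd (h2.trans h1.symm)

lemma eq_of_aligned {d e : D} (hd : d ∉ G.hole) (he : e ∉ G.hole) (h : G.Aligned d e)
    (hs : G.strip (G.next d) = G.strip (G.next e)) : d = e := by
  obtain ⟨n, h | h⟩ := h <;> rcases Nat.eq_zero_or_pos n with rfl | hn
  · exact h.2
  · exact absurd hs.symm (hA.strip_next_reach_ne n d e hn h he)
  · exact h.2.symm
  · exact absurd hs (hA.strip_next_reach_ne n e d hn h hd)

lemma crossings_subsingleton (S T : G.Strip) : (G.crossings S T).Subsingleton := by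
  rintro q ⟨d, hd, rfl, hd1, hd2⟩ r ⟨e, he, rfl, he1, he2⟩
  rcases aligned_or_aligned_rev (hd1.trans he1.symm) with h | h
  · rw [hA.eq_of_aligned hd he h (hd2.trans he2.symm)]
  · have h' : G.Aligned d (G.next (G.next e)) := by
      have := (aligned_across he).rev
      rw [across, G.rev_rev] at this
      exact h.trans this
    have he' := next_notMem (next_notMem he)
    rw [hA.eq_of_aligned hd he' h' (by rw [strip_next_three he]; exact hd2.trans he2.symm)]
    exact Quotient.sound (Equiv.Perm.SameCycle.symm ⟨2, rfl⟩)

end IsArrangement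

end QuadGraph

namespace QuadGraph

variable {V : Type u} {D : Type v} {G : QuadGraph V D}

/-! ### Geodesics -/

variable (G) in
/-- A walk that crosses no strip twice. -/
def IsGeodesic (x : V) (l : List D) (y : V) : Prop := G.IsWalk x l y ∧ (l.map G.strip).Nodup

lemma eq_of_ne_of_ne {a b c : ZMod 2} (h : a ≠ b) (h' : c ≠ b) : a = c := by
  revert a b c
  decide

namespace IsArrangement

variable (hA : G.IsArrangement)

/-- The side of a strip on which a vertex lies. -/
noncomputable def side (T : G.Strip) : V → ZMod 2 := (hA.exists_side T).choose

lemma side_tgt_ne (d : D) : hA.side (G.strip d) (G.tgt d) ≠ hA.side (G.strip d) (G.src d) :=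
  ((hA.exists_side _).choose_spec d).1 rfl

lemma side_tgt_eq {d : D} {T : G.Strip} (h : G.strip d ≠ T) :
    hA.side T (G.tgt d) = hA.side T (G.src d) :=
  ((hA.exists_side T).choose_spec d).2 h

include hA in
lemma src_ne_tgt (d : D) : G.src d ≠ G.tgt d := fun h => hA.side_tgt_ne d (by rw [h])

lemma side_eq_of_isWalk {T : G.Strip} {x y : V} {l : List D} (h : G.IsWalk x l y)
    (hT : T ∉ l.map G.strip) : hA.side T y = hA.side T x := by
  induction l generalizing x with
  | nil => rw [show x = y from h]
  | cons d l ih =>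
    obtain ⟨rfl, h⟩ := h
    rw [List.map_cons, List.mem_cons, not_or] at hT
    rw [ih h hT.2]
    exact hA.side_tgt_eq fun h => hT.1 h.symm

/-- The side of `T` changes exactly when `T` is crossed, and a geodesic crosses it at most once. So
the strips crossed depend only on the end points, and all geodesics between these have the same
length. -/
lemma mem_strips_iff {T : G.Strip} {x y : V} {l : List D} (h : G.IsGeodesic x l y) :
    T ∈ l.map G.strip ↔ hA.side T y ≠ hA.side T x := by
  induction l generalizing x with
  | nil => simp [show x = y from h.1]
  | cons d l ih =>
    obtain ⟨⟨rfl, h⟩, hn⟩ := h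
    rw [List.map_cons, List.nodup_cons] at hn
    rw [List.map_cons, List.mem_cons]
    by_cases hT : T = G.strip d
    · subst hT
      rw [hA.side_eq_of_isWalk h hn.1]
      exact ⟨fun _ => hA.side_tgt_ne d, fun _ => Or.inl rfl⟩
    · have e := ih ⟨h, hn.2⟩
      rw [show G.src (G.rev d) = G.tgt d from rfl,
        hA.side_tgt_eq (d := d) (T := T) fun h => hT h.symm] at e
      exact ⟨fun h => e.1 (h.resolve_left hT), fun h => Or.inr (e.2 h)⟩

include hA in
lemma strips_perm {x y : V} {l m : List D} (hl : G.IsGeodesic x l y) (hm : G.IsGeodesic x m y) :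
    (l.map G.strip).Perm (m.map G.strip) :=
  (List.perm_ext_iff_of_nodup hl.2 hm.2).2 fun _ =>
    (hA.mem_strips_iff hl).trans (hA.mem_strips_iff hm).symm

include hA in
lemma eq_nil_of_isGeodesic {x : V} {l : List D} (h : G.IsGeodesic x l x) : l = [] := by
  have := hA.strips_perm h (m := []) ⟨rfl, List.nodup_nil⟩
  simpa using this.length_eq

end IsArrangement

/-! ### Ladders -/

variable (G) in
/-- The edges `d` and `d₁` are opposite edges of a quad, and `a` and `a'` lead from `d` to `d₁`
along the other two edges. -/
inductive Rung : D → D → D → D → Prop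
  | fwd (q : D) (hq : q ∉ G.hole) :
      Rung q (G.across q) (G.rev (G.next (G.next (G.next q)))) (G.next q)
  | bwd (q : D) (hq : q ∉ G.hole) :
      Rung (G.across q) q (G.next (G.next (G.next q))) (G.rev (G.next q))

variable (G) in
/-- The pieces of a strip from `d` to `e`, together with the walks along both its sides. -/
inductive Ladder : D → List D → List D → D → Prop
  | nil (d : D) : Ladder d [] [] d
  | cons {d d₁ a a' e : D} {σ σ' : List D} (h : G.Rung d d₁ a a') (h' : Ladder d₁ σ σ' e) :
      Ladder d (a :: σ) (a' :: σ') e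

namespace Rung

variable {d d₁ a a' : D} (h : G.Rung d d₁ a a')
include h

lemma src_left : G.src a = G.src d := by
  cases h with
  | fwd _ hq => rw [src_rev, tgt_next_three hq]
  | bwd _ hq => rw [src_across]

lemma tgt_left : G.tgt a = G.src d₁ := by
  cases h with
  | fwd _ hq => rw [tgt_rev, src_across]
  | bwd _ hq => rw [tgt_next_three hq]

lemma src_right : G.src a' = G.tgt d := by
  cases h with
  | fwd _ hq => rw [src_next_eq]
  | bwd _ hq => rw [src_rev, tgt_across, src_next_eq]

lemma tgt_right : G.tgt a' = G.tgt d₁ := by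
  cases h with
  | fwd _ hq => rw [tgt_across, src_next_eq]
  | bwd _ hq => rw [tgt_rev, src_next_eq]

lemma strip_right : G.strip a' = G.strip a := by
  cases h with
  | fwd _ hq => rw [strip_rev, strip_next_three hq]
  | bwd _ hq => rw [strip_rev, strip_next_three hq]

lemma strip_eq : G.strip d₁ = G.strip d := by
  cases h with
  | fwd _ hq => rw [strip_across hq]
  | bwd _ hq => rw [strip_across hq]

lemma strip_ne (hA : G.IsArrangement) : G.strip a ≠ G.strip d := by
  cases h with
  | fwd _ hq => rw [strip_rev, strip_next_three hq]; exact hA.strip_next_ne _ hq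
  | bwd _ hq => rw [strip_across hq, strip_next_three hq]; exact hA.strip_next_ne _ hq

lemma symm : G.Rung d₁ d (G.rev a) (G.rev a') := by
  cases h with
  | fwd _ hq => rw [G.rev_rev]; exact Rung.bwd _ hq
  | bwd _ hq => rw [G.rev_rev]; exact Rung.fwd _ hq

end Rung

namespace Ladder

variable {d e : D} {σ σ' : List D}

lemma isWalk_left (h : G.Ladder d σ σ' e) : G.IsWalk (G.src d) σ (G.src e) := by
  induction h with
  | nil => rfl
  | cons h _ ih => exact ⟨h.src_left, by rw [src_rev, h.tgt_left]; exact ih⟩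

lemma isWalk_right (h : G.Ladder d σ σ' e) : G.IsWalk (G.tgt d) σ' (G.tgt e) := by
  induction h with
  | nil => rfl
  | cons h _ ih => exact ⟨h.src_right, by rw [src_rev, h.tgt_right]; exact ih⟩

lemma strips_right (h : G.Ladder d σ σ' e) : σ'.map G.strip = σ.map G.strip := by
  induction h with
  | nil => rfl
  | cons h _ ih => rw [List.map_cons, List.map_cons, h.strip_right, ih]

lemma strip_notMem (hA : G.IsArrangement) (h : G.Ladder d σ σ' e) :
    G.strip d ∉ σ.map G.strip := by
  induction h with
  | nil => simp
  | cons h _ ih =>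
    rw [List.map_cons, List.mem_cons, not_or]
    exact ⟨(h.strip_ne hA).symm, by rwa [← h.strip_eq]⟩

lemma append {f : D} {τ τ' : List D} (h : G.Ladder d σ σ' e) (h' : G.Ladder e τ τ' f) :
    G.Ladder d (σ ++ τ) (σ' ++ τ') f := by
  induction h with
  | nil => exact h'
  | cons h _ ih => exact cons h (ih h')

lemma reverse (h : G.Ladder d σ σ' e) :
    G.Ladder e (σ.map G.rev).reverse (σ'.map G.rev).reverse d := by
  induction h with
  | nil => exact nil _
  | cons h _ ih =>
    simp only [List.map_cons, List.reverse_cons]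
    exact ih.append (cons h.symm (nil _))

end Ladder

lemma Reach.exists_ladder {n : ℕ} {d e : D} (h : G.Reach n d e) : ∃ σ σ', G.Ladder d σ σ' e ∧
    σ.map G.strip = (List.range n).map fun k => G.strip (G.next (G.across^[k] d)) := by
  induction n generalizing e with
  | zero =>
    obtain ⟨-, rfl⟩ := h
    exact ⟨[], [], Ladder.nil _, rfl⟩
  | succ n ih =>
    obtain ⟨h1, h2⟩ := h.split
    obtain rfl : G.across (G.across^[n] d) = e := h2.2
    have hm : G.across^[n] d ∉ G.hole := h2.1 0 one_pos
    obtain ⟨σ, σ', hl, hs⟩ := ih h1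
    refine ⟨_, _, hl.append (Ladder.cons (Rung.fwd _ hm) (Ladder.nil _)), ?_⟩
    rw [List.map_append, hs, List.range_succ, List.map_append]
    simp [strip_rev, strip_next_three hm]

/-- Strips do not meet twice; therefore both sides of a stretch of a strip are geodesics. -/
lemma Reach.nodup_strips (hA : G.IsArrangement) {n : ℕ} {d e : D} (h : G.Reach n d e) :
    ((List.range n).map fun k => G.strip (G.next (G.across^[k] d))).Nodup := by
  refine List.Nodup.map_on ?_ List.nodup_range
  have key : ∀ i j, i < j → j < n →
      G.strip (G.next (G.across^[j] d)) ≠ G.strip (G.next (G.across^[i] d)) := by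
    intro i j hij hj
    obtain ⟨k, rfl⟩ := Nat.exists_eq_add_of_lt hij
    have h1 : G.Reach (i + (k + 1)) d (G.across^[i + k + 1] d) :=
      ⟨fun m hm => h.1 m (by omega), rfl⟩
    exact hA.strip_next_reach_ne (k + 1) _ _ (Nat.succ_pos k) h1.split.2 (h.1 _ hj)
  intro i hi j hj hij
  rw [List.mem_range] at hi hj
  by_contra hne
  rcases Nat.lt_or_gt_of_ne hne with h1 | h1
  · exact key i j h1 hj hij.symm
  · exact key j i h1 hi hij

lemma Aligned.exists_ladder (hA : G.IsArrangement) {d e : D} (h : G.Aligned d e) :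
    ∃ σ σ', G.Ladder d σ σ' e ∧ (σ.map G.strip).Nodup := by
  obtain ⟨n, h | h⟩ := h
  · obtain ⟨σ, σ', hl, hn⟩ := h.exists_ladder
    exact ⟨σ, σ', hl, hn ▸ h.nodup_strips hA⟩
  · obtain ⟨σ, σ', hl, hn⟩ := h.exists_ladder
    refine ⟨_, _, hl.reverse, ?_⟩
    rw [List.map_reverse, List.nodup_reverse, List.map_map]
    have : G.strip ∘ G.rev = G.strip := funext strip_rev
    rw [this, hn]
    exact h.nodup_strips hA

namespace IsArrangement

variable (hA : G.IsArrangement)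

lemma side_src_eq_of_aligned {d e : D} (h : G.Aligned d e) :
    hA.side (G.strip d) (G.src e) = hA.side (G.strip d) (G.src d) := by
  obtain ⟨σ, σ', hl, -⟩ := h.exists_ladder hA
  exact hA.side_eq_of_isWalk hl.isWalk_left (hl.strip_notMem hA)

/-- The opposite orientation would put both ends of `e` on the same side of its own strip. -/
lemma aligned_of_side_eq {d e : D} (h : G.strip e = G.strip d)
    (hs : hA.side (G.strip d) (G.src e) = hA.side (G.strip d) (G.src d)) : G.Aligned d e := by
  rcases aligned_or_aligned_rev h.symm with h1 | h1
  · exact h1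
  · have h2 := hA.side_src_eq_of_aligned h1
    rw [src_rev, ← hs, ← h] at h2
    exact absurd h2 (hA.side_tgt_ne e)

end IsArrangement

/-! ### Convexity -/

variable (G) in
/-- A set of vertices that is closed under the rule that three vertices of a quad determine the
fourth one. -/
def QuadClosed (K : Set V) : Prop := ∀ d, d ∉ G.hole → G.src d ∈ K → G.src (G.next d) ∈ K →
  G.src (G.next (G.next d)) ∈ K → G.src (G.next (G.next (G.next d))) ∈ K

lemma QuadClosed.mem_zero {K : Set V} (hK : G.QuadClosed K) {d : D} (hd : d ∉ G.hole)
    (h1 : G.src (G.next d) ∈ K) (h2 : G.src (G.next (G.next d)) ∈ K)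
    (h3 : G.src (G.next (G.next (G.next d))) ∈ K) : G.src d ∈ K := by
  simpa only [next_four hd] using hK (G.next d) (next_notMem hd) h1 h2 h3

lemma QuadClosed.mem_one {K : Set V} (hK : G.QuadClosed K) {d : D} (hd : d ∉ G.hole)
    (h2 : G.src (G.next (G.next d)) ∈ K) (h3 : G.src (G.next (G.next (G.next d))) ∈ K)
    (h0 : G.src d ∈ K) : G.src (G.next d) ∈ K := by
  refine hK.mem_zero (next_notMem hd) h2 h3 ?_
  rwa [next_four hd]

lemma QuadClosed.mem_two {K : Set V} (hK : G.QuadClosed K) {d : D} (hd : d ∉ G.hole)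
    (h3 : G.src (G.next (G.next (G.next d))) ∈ K) (h0 : G.src d ∈ K)
    (h1 : G.src (G.next d) ∈ K) : G.src (G.next (G.next d)) ∈ K := by
  refine hK.mem_one (next_notMem hd) h3 ?_ h1
  rwa [next_four hd]

lemma Rung.tgt_mem {K : Set V} (hK : G.QuadClosed K) {d d₁ a a' : D} (h : G.Rung d d₁ a a')
    (h0 : G.src d ∈ K) (h1 : G.src d₁ ∈ K) (h2 : G.tgt d ∈ K) : G.tgt d₁ ∈ K := by
  cases h with
  | fwd q hq =>
    rw [src_across] at h1
    rw [tgt_across]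
    exact hK.mem_two hq h1 h0 (by rwa [src_next_eq])
  | bwd q hq =>
    rw [src_across] at h0
    rw [tgt_across] at h2
    rw [← src_next_eq]
    exact hK.mem_one hq h2 h0 h1

variable (G) in
/-- `l` is a walk from `x` to `y` all of whose vertices lie in `K`. -/
def WalkIn (K : Set V) : V → List D → V → Prop
  | x, [], y => x ∈ K ∧ x = y
  | x, d :: l, y => x ∈ K ∧ G.src d = x ∧ WalkIn K (G.tgt d) l y

namespace WalkIn

variable {K : Set V} {x y : V} {l : List D}

lemma isWalk (h : G.WalkIn K x l y) : G.IsWalk x l y := by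
  induction l generalizing x with
  | nil => exact h.2
  | cons d l ih => exact ⟨h.2.1, ih h.2.2⟩

lemma left_mem (h : G.WalkIn K x l y) : x ∈ K := by
  cases l with
  | nil => exact h.1
  | cons d l => exact h.1

lemma mono {L : Set V} (hKL : K ⊆ L) (h : G.WalkIn K x l y) : G.WalkIn L x l y := by
  induction l generalizing x with
  | nil => exact ⟨hKL h.1, h.2⟩
  | cons d l ih => exact ⟨hKL h.1, h.2.1, ih h.2.2⟩

lemma green (h : G.WalkIn K x l y) {d : D} (hd : d ∈ l) : G.src d ∈ K ∧ G.tgt d ∈ K := by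
  induction l generalizing x with
  | nil => simp at hd
  | cons e l ih =>
    rcases List.mem_cons.1 hd with rfl | hd
    · exact ⟨h.2.1 ▸ h.1, h.2.2.left_mem⟩
    · exact ih h.2.2 hd

lemma of_tgt_mem (h : G.IsWalk x l y) (hx : x ∈ K) (hl : ∀ d ∈ l, G.tgt d ∈ K) :
    G.WalkIn K x l y := by
  induction l generalizing x with
  | nil => exact ⟨hx, h⟩
  | cons d l ih =>
    exact ⟨hx, h.1, ih h.2 (hl d (List.mem_cons_self ..)) fun e he =>
      hl e (List.mem_cons_of_mem _ he)⟩

end WalkIn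

lemma walkIn_append {K : Set V} {x y : V} {l m : List D} :
    G.WalkIn K x (l ++ m) y ↔ ∃ z, G.WalkIn K x l z ∧ G.WalkIn K z m y := by
  induction l generalizing x with
  | nil =>
    refine ⟨fun h => ⟨x, ⟨h.left_mem, rfl⟩, h⟩, ?_⟩
    rintro ⟨z, ⟨-, rfl⟩, h⟩
    exact h
  | cons d l ih => simp [WalkIn, ih, and_assoc]

/-- The quad rule passes knowledge from rung to rung: one side of a strip together with a single
vertex of the other side gives the whole other side. In `fill_back` the propagation starts at the
far end. -/
lemma Ladder.fill {K : Set V} (hK : G.QuadClosed K) {d e : D} {σ σ' : List D}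
    (h : G.Ladder d σ σ' e) (hσ : G.WalkIn K (G.src d) σ (G.src e)) (hd : G.tgt d ∈ K) :
    G.WalkIn K (G.tgt d) σ' (G.tgt e) := by
  induction h with
  | nil => exact ⟨hd, rfl⟩
  | cons h _ ih =>
    obtain ⟨h0, -, h1⟩ := hσ
    rw [h.tgt_left] at h1
    have h2 := ih h1 (h.tgt_mem hK h0 h1.left_mem hd)
    rw [← h.tgt_right] at h2
    exact ⟨hd, h.src_right, h2⟩

lemma Ladder.fill_back {K : Set V} (hK : G.QuadClosed K) {d e : D} {σ σ' : List D}
    (h : G.Ladder d σ σ' e) (hσ : G.WalkIn K (G.src d) σ (G.src e)) (he : G.tgt e ∈ K) :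
    G.WalkIn K (G.tgt d) σ' (G.tgt e) := by
  induction h with
  | nil => exact ⟨he, rfl⟩
  | cons h _ ih =>
    obtain ⟨h0, -, h1⟩ := hσ
    rw [h.tgt_left] at h1
    have h2 := ih h1 he
    refine ⟨h.symm.tgt_mem hK h1.left_mem h0 h2.left_mem, h.src_right, ?_⟩
    rwa [h.tgt_right]

namespace IsArrangement

variable (hA : G.IsArrangement)
include hA

/-- A set that is closed under the quad rule contains, with a geodesic, all geodesics with the
same end points. -/
theorem walkIn_of_isGeodesic {K : Set V} (hK : G.QuadClosed K) {x y : V} {l m : List D}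
    (hl : G.WalkIn K x l y) (hln : (l.map G.strip).Nodup) (hm : G.IsGeodesic x m y) :
    G.WalkIn K x m y := by
  obtain ⟨n, hn⟩ : ∃ n, n = l.length := ⟨_, rfl⟩
  induction n using Nat.strong_induction_on generalizing x y l m with
  | _ n ih =>
  subst hn
  cases m with
  | nil => exact ⟨hl.left_mem, hm.1⟩
  | cons d m =>
  obtain ⟨⟨rfl, hm1⟩, hm2⟩ := hm
  have hperm := hA.strips_perm ⟨hl.isWalk, hln⟩ (m := d :: m) ⟨⟨rfl, hm1⟩, hm2⟩
  have hd : G.strip d ∈ l.map G.strip := hperm.mem_iff.2 (by simp)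
  obtain ⟨e, he, hed⟩ := List.mem_map.1 hd
  obtain ⟨l₁, l₂, rfl⟩ := List.append_of_mem he
  rw [walkIn_append] at hl
  obtain ⟨z, hl1, hz, rfl, hl2⟩ := hl
  rw [List.map_append, List.map_cons, List.nodup_append] at hln
  obtain ⟨hn1, hn2, hn12⟩ := hln
  rw [List.nodup_cons] at hn2
  have hd1 : G.strip d ∉ l₁.map G.strip := fun h => hn12 _ h _ (by simp) hed.symm
  have hal := hA.aligned_of_side_eq hed (hA.side_eq_of_isWalk hl1.isWalk hd1)
  -- The geodesic `l` crosses the strip of `d` at `e`. One side of the strip between `d` and `e` has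
  -- the same ends as `l₁`, which is shorter than `l`; by induction it lies in `K`, and then so does
  -- the other side `σ'`.
  obtain ⟨σ, σ', hL, hσ⟩ := hal.exists_ladder hA
  have hσK := ih _ (by simp) hl1 hn1 ⟨hL.isWalk_left, hσ⟩ rfl
  have hσK' := hL.fill_back hK hσK hl2.left_mem
  have hp := hA.strips_perm ⟨hl1.isWalk, hn1⟩ ⟨hL.isWalk_left, hσ⟩
  have hlen : l₁.length = σ'.length := by
    have h1 := hp.length_eq
    rw [← hL.strips_right] at h1
    simpa using h1
  -- This geodesic in `K` starts at the end of `d` and is one edge shorter than `l`, so induction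
  -- applies to the rest of `m`.
  have hw : G.WalkIn K (G.tgt d) (σ' ++ l₂) y := walkIn_append.2 ⟨_, hσK', hl2⟩
  have hwn : ((σ' ++ l₂).map G.strip).Nodup := by
    rw [List.map_append, List.nodup_append, hL.strips_right]
    refine ⟨hσ, hn2.2, fun a ha b hb => ?_⟩
    exact hn12 a (hp.mem_iff.2 ha) b (List.mem_cons_of_mem _ hb)
  rw [List.map_cons, List.nodup_cons] at hm2
  exact ⟨hl1.left_mem, rfl, ih _ (by simp; omega) hw hwn ⟨hm1, hm2.2⟩ rfl⟩

/-- Two vertices that are joined by a walk inside a set that is closed under the quad rule are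
joined by a geodesic inside this set. -/
theorem exists_isGeodesic_walkIn {K : Set V} (hK : G.QuadClosed K) {x y : V} {l : List D}
    (hl : G.WalkIn K x l y) : ∃ m, G.WalkIn K x m y ∧ (m.map G.strip).Nodup := by
  induction l generalizing x with
  | nil => exact ⟨[], hl, List.nodup_nil⟩
  | cons d l ih =>
  obtain ⟨hx, rfl, hl⟩ := hl
  obtain ⟨m, hm, hmn⟩ := ih hl
  by_cases hd : G.strip d ∈ m.map G.strip
  · obtain ⟨e, he, hed⟩ := List.mem_map.1 hd
    obtain ⟨m₁, m₂, rfl⟩ := List.append_of_mem he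
    rw [walkIn_append] at hm
    obtain ⟨z, hm1, hz, rfl, hm2⟩ := hm
    rw [List.map_append, List.map_cons, List.nodup_append] at hmn
    obtain ⟨hn1, hn2, hn12⟩ := hmn
    rw [List.nodup_cons] at hn2
    have hd1 : G.strip d ∉ m₁.map G.strip := fun h => hn12 _ h _ (by simp) hed.symm
    -- The walk crosses the strip of `d` and returns across it at `e`. The stretch `d`, `m₁`, `e` is
    -- replaced by the walk along the near side of the strip, which avoids both crossings.
    have hal : G.Aligned (G.rev d) e := by
      refine hA.aligned_of_side_eq (by rw [strip_rev, hed]) ?_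
      rw [strip_rev, src_rev]
      exact hA.side_eq_of_isWalk hm1.isWalk hd1
    obtain ⟨σ, σ', hL, hσ⟩ := hal.exists_ladder hA
    have hσK := hA.walkIn_of_isGeodesic hK hm1 hn1 ⟨hL.isWalk_left, hσ⟩
    have hσK' := hL.fill hK hσK (by rwa [tgt_rev])
    rw [tgt_rev] at hσK'
    have hp := hA.strips_perm ⟨hm1.isWalk, hn1⟩ ⟨hL.isWalk_left, hσ⟩
    refine ⟨σ' ++ m₂, walkIn_append.2 ⟨_, hσK', hm2⟩, ?_⟩
    rw [List.map_append, List.nodup_append, hL.strips_right]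
    refine ⟨hσ, hn2.2, fun a ha b hb => ?_⟩
    exact hn12 a (hp.mem_iff.2 ha) b (List.mem_cons_of_mem _ hb)
  · exact ⟨d :: m, ⟨hx, rfl, hm⟩, by rw [List.map_cons, List.nodup_cons]; exact ⟨hd, hmn⟩⟩

end IsArrangement

variable (G) in
/-- A set of vertices that is closed under the quad rule and that spans a connected subgraph. -/
structure IsConvex (K : Set V) : Prop where
  quadClosed : G.QuadClosed K
  exists_walkIn : ∀ x ∈ K, ∀ y ∈ K, ∃ l, G.WalkIn K x l y

namespace IsConvex

variable {K : Set V} (hK : G.IsConvex K) (hA : G.IsArrangement)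
include hK hA

lemma exists_geodesic {x y : V} (hx : x ∈ K) (hy : y ∈ K) :
    ∃ l, G.WalkIn K x l y ∧ (l.map G.strip).Nodup := by
  obtain ⟨l, hl⟩ := hK.exists_walkIn x hx y hy
  exact hA.exists_isGeodesic_walkIn hK.quadClosed hl

lemma walkIn {x y : V} {l : List D} (hx : x ∈ K) (hy : y ∈ K) (hl : G.IsGeodesic x l y) :
    G.WalkIn K x l y := by
  obtain ⟨m, hm, hmn⟩ := hK.exists_geodesic hA hx hy
  exact hA.walkIn_of_isGeodesic hK.quadClosed hm hmn hl

/-- If one edge of a strip lies in `K`, then all edges of this strip that have a vertex in `K`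
lie in `K`. -/
lemma tgt_mem {d e : D} (hd : G.src d ∈ K) (he : G.src e ∈ K) (he' : G.tgt e ∈ K)
    (hs : G.strip e = G.strip d) : G.tgt d ∈ K := by
  have key : ∀ f, G.src f ∈ K → G.tgt f ∈ K → G.Aligned d f → G.tgt d ∈ K := by
    intro f hf hf' hal
    obtain ⟨σ, σ', hL, hσ⟩ := hal.exists_ladder hA
    have h1 := hK.walkIn hA hd hf ⟨hL.isWalk_left, hσ⟩
    exact (hL.fill_back hK.quadClosed h1 hf').left_mem
  rcases aligned_or_aligned_rev hs.symm with h | h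
  · exact key e he he' h
  · exact key (G.rev e) he' (by rwa [tgt_rev]) h

end IsConvex

end QuadGraph

namespace QuadGraph

variable {V : Type u} {D : Type v} {G : QuadGraph V D}

/-! ### The construction method -/

variable (G) in
/-- The strips that have a green piece. -/
def greenStrips (K : Set V) : Set G.Strip := {S | ∃ e, G.strip e = S ∧ G.Green K e}

lemma greenStrips_mono {K L : Set V} (h : K ⊆ L) : G.greenStrips K ⊆ G.greenStrips L := by
  rintro S ⟨e, he, h1, h2⟩
  exact ⟨e, he, h h1, h h2⟩

variable (G) in
/-- The set of vertices determined by those in `K`. -/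
def closure (K : Set V) : Set V := {y | G.Determined K y}

lemma subset_closure (K : Set V) : K ⊆ G.closure K := fun _ hx => Determined.known hx

lemma quadClosed_closure (K : Set V) : G.QuadClosed (G.closure K) := fun d hd h0 h1 h2 =>
  Determined.fourth d hd h0 h1 h2

lemma QuadClosed.closure_subset {K L : Set V} (hL : G.QuadClosed L) (h : K ⊆ L) :
    G.closure K ⊆ L := by
  intro x hx
  induction hx with
  | known hx => exact h hx
  | fourth d hd _ _ _ h0 h1 h2 => exact hL d hd h0 h1 h2

lemma Run.nonempty {I K : Set V} (h : G.Run I K) : K.Nonempty := by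
  cases h with
  | start x => exact ⟨x, rfl⟩
  | step d h hd => exact ⟨_, subset_closure _ (Set.mem_insert _ _)⟩

lemma Run.subset {I K : Set V} (h : G.Run I K) : I ⊆ K := by
  induction h with
  | start x => exact subset_rfl
  | step d h hd ih => exact (Set.insert_subset_insert ih).trans (subset_closure _)

lemma Run.subset_of_quadClosed {I K L : Set V} (h : G.Run I K) (hL : G.QuadClosed L)
    (hI : I ⊆ L) : K ⊆ L := by
  induction h with
  | start x => exact hI
  | step d h hd ih =>
    rw [Set.insert_subset_iff] at hI
    exact hL.closure_subset (Set.insert_subset hI.1 (ih hI.2))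

lemma Run.finite {I K : Set V} (h : G.Run I K) : I.Finite := by
  induction h with
  | start x => exact Set.finite_singleton x
  | step d h hd ih => exact ih.insert _

namespace IsArrangement

variable (hA : G.IsArrangement)
include hA

lemma isConvex_singleton (x : V) : G.IsConvex {x} := by
  refine ⟨fun d _ h0 h1 _ => ?_, ?_⟩
  · rw [src_next_eq] at h1
    exact absurd (Eq.trans h0 (Eq.symm h1)) (hA.src_ne_tgt d)
  · rintro a rfl b rfl
    exact ⟨[], rfl, rfl⟩

lemma greenStrips_singleton (x : V) : G.greenStrips {x} = ∅ := by
  rw [Set.eq_empty_iff_forall_notMem]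
  rintro S ⟨e, -, h1, h2⟩
  exact hA.src_ne_tgt e (Eq.trans h1 (Eq.symm h2))

/-- This controls the closure: it stays connected, and its vertices are reached without crossing any
strip other than the green ones and that of `d`. -/
lemma exists_walkIn_closure_insert {K : Set V} (hK : G.IsConvex K) {d : D} (hd : G.src d ∈ K)
    {y : V} (hy : y ∈ G.closure (insert (G.tgt d) K)) :
    ∃ l, G.WalkIn (G.closure (insert (G.tgt d) K)) (G.src d) l y ∧
      ∀ e ∈ l, G.strip e ∈ insert (G.strip d) (G.greenStrips K) := by
  induction hy with
  | known hx =>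
    rcases hx with rfl | hx
    · refine ⟨[d], ⟨subset_closure _ (Or.inr hd), rfl, subset_closure _ (Or.inl rfl), rfl⟩, ?_⟩
      rintro e he
      rw [List.mem_singleton.1 he]
      exact Or.inl rfl
    · obtain ⟨l, hl⟩ := hK.exists_walkIn _ hd _ hx
      refine ⟨l, hl.mono ((Set.subset_insert _ _).trans (subset_closure _)), fun e he => ?_⟩
      exact Or.inr ⟨e, rfl, hl.green he⟩
  | fourth f hf hk0 hk1 hk2 h0 h1 h2 =>
    obtain ⟨l0, hl0, hs0⟩ := h0
    obtain ⟨l1, hl1, hs1⟩ := h1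
    obtain ⟨l2, hl2, hs2⟩ := h2
    refine ⟨l2 ++ [G.next (G.next f)], walkIn_append.2 ⟨_, hl2, hk2, rfl, ?_⟩, ?_⟩
    · have h3 := Determined.fourth f hf hk0 hk1 hk2
      rw [src_next_eq (G.next (G.next f))] at h3
      exact ⟨h3, (src_next_eq _).symm⟩
    · intro e he
      rcases List.mem_append.1 he with he | he
      · exact hs2 e he
      · rw [List.mem_singleton.1 he, strip_next_next hf]
        -- The added edge lies on the strip of `f`, both ends of which are already reached. If this
        -- strip were not allowed, the walks to these ends would avoid it, leaving them on the same
        -- side of it.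
        by_contra hne
        have e0 := hA.side_eq_of_isWalk (T := G.strip f) hl0.isWalk (by
          rintro h
          obtain ⟨g, hg, hgf⟩ := List.mem_map.1 h
          exact hne (hgf ▸ hs0 g hg))
        have e1 := hA.side_eq_of_isWalk (T := G.strip f) hl1.isWalk (by
          rintro h
          obtain ⟨g, hg, hgf⟩ := List.mem_map.1 h
          exact hne (hgf ▸ hs1 g hg))
        rw [src_next_eq] at e1
        exact hA.side_tgt_ne f (e1.trans e0.symm)

lemma isConvex_closure_insert {K : Set V} (hK : G.IsConvex K) {d : D} (hd : G.src d ∈ K) :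
    G.IsConvex (G.closure (insert (G.tgt d) K)) := by
  refine ⟨quadClosed_closure _, fun x hx y hy => ?_⟩
  obtain ⟨l, hl, -⟩ := hA.exists_walkIn_closure_insert hK hd hx
  obtain ⟨m, hm, -⟩ := hA.exists_walkIn_closure_insert hK hd hy
  refine ⟨(l.map G.rev).reverse ++ m, walkIn_append.2 ⟨_, ?_, hm⟩⟩
  refine WalkIn.of_tgt_mem hl.isWalk.reverse hx fun e he => ?_
  rw [List.mem_reverse, List.mem_map] at he
  obtain ⟨f, hf, rfl⟩ := he
  rw [tgt_rev]
  exact (hl.green hf).1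

/-- Both ends of a green edge on any further strip would be reached by walks that avoid this strip,
which separates them. Thus propagation makes no strip green beyond that of `d`. -/
lemma greenStrips_closure_insert {K : Set V} (hK : G.IsConvex K) {d : D} (hd : G.src d ∈ K) :
    G.greenStrips (G.closure (insert (G.tgt d) K)) =
      insert (G.strip d) (G.greenStrips K) := by
  apply Set.Subset.antisymm
  · rintro S ⟨e, rfl, h1, h2⟩
    by_contra hne
    obtain ⟨l, hl, hls⟩ := hA.exists_walkIn_closure_insert hK hd h1
    obtain ⟨m, hm, hms⟩ := hA.exists_walkIn_closure_insert hK hd h2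
    have e0 := hA.side_eq_of_isWalk (T := G.strip e) hl.isWalk (by
      rintro h
      obtain ⟨g, hg, hgf⟩ := List.mem_map.1 h
      exact hne (hgf ▸ hls g hg))
    have e1 := hA.side_eq_of_isWalk (T := G.strip e) hm.isWalk (by
      rintro h
      obtain ⟨g, hg, hgf⟩ := List.mem_map.1 h
      exact hne (hgf ▸ hms g hg))
    exact hA.side_tgt_ne e (e1.trans e0.symm)
  · refine Set.insert_subset ⟨d, rfl, ?_, ?_⟩ (greenStrips_mono
      ((Set.subset_insert _ _).trans (subset_closure _)))
    · exact subset_closure _ (Or.inr hd)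
    · exact subset_closure _ (Or.inl rfl)

end IsArrangement

namespace Run

variable {I K : Set V} (h : G.Run I K) (hA : G.IsArrangement)
include h hA

lemma isConvex : G.IsConvex K := by
  induction h with
  | start x => exact hA.isConvex_singleton x
  | step d h hd ih => exact hA.isConvex_closure_insert ih hd.1

lemma encard_eq : I.encard = (G.greenStrips K).encard + 1 := by
  induction h with
  | start x => rw [hA.greenStrips_singleton, Set.encard_singleton, Set.encard_empty, zero_add]
  | @step I K d h hd ih =>
    have h1 : G.src (G.rev d) ∉ I := fun h1 => hd.2.1 (h.subset h1)
    have h2 : G.strip d ∉ G.greenStrips K := by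
      rintro ⟨e, he, hg⟩
      exact hd.2.2 e he hg
    have h3 := hA.greenStrips_closure_insert (h.isConvex hA) hd.1
    rw [Set.encard_insert_of_notMem h1, ih]
    change _ = (G.greenStrips (G.closure (insert (G.tgt d) K))).encard + 1
    rw [h3, Set.encard_insert_of_notMem h2]

end Run

namespace IsConvex

variable {K : Set V} (hK : G.IsConvex K) (hA : G.IsArrangement)
include hK hA

/-- A piece of the enclosure is orange. -/
lemma isOrangeEnclosing {d : D} (h : G.src d ∈ K) (h' : G.tgt d ∉ K) :
    G.IsOrangeEnclosing K d :=
  ⟨h, h', fun _ he hg => h' (hK.tgt_mem hA h hg.1 hg.2 he)⟩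

/-- The exit tracked back to would supply a green piece on the curve of the enclosing pair. By
convexity such a curve has no enclosing piece. -/
lemma not_tracksBack {p q : D} (hp : G.IsExit K p) : ¬ G.TracksBack K p q := by
  rintro ⟨⟨hq, hg, -⟩, n, -, hn, hk⟩
  have hr : G.Reach n q (G.across^[n] q) := by
    refine ⟨fun k hkn => ?_, rfl⟩
    rcases Nat.eq_zero_or_pos k with rfl | h0
    · exact hq
    · exact (hk k h0 hkn.le).1
  obtain ⟨hph, hpg, hp2, hp3⟩ := hp
  have hs := hr.strip_eq
  rcases hn with hn | hn
  · rw [hn] at hs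
    refine hp2 ?_
    rw [src_next_eq]
    exact hK.tgt_mem hA (by rw [src_next_eq]; exact hpg.2) hg.1 hg.2 hs.symm
  · rw [hn] at hs
    refine hp3 ?_
    rw [← tgt_rev]
    refine hK.tgt_mem hA ?_ hg.1 hg.2 (by rw [strip_rev, hs])
    rw [src_rev, tgt_next_three hph]
    exact hpg.1

lemma not_isEntangled (A : Set G.Strip) : ¬ G.IsEntangled K A := by
  rintro ⟨n, p, hn, -, hp, ht, -⟩
  exact hK.not_tracksBack hA hp (ht 0 hn)

end IsConvex

lemma WalkIn.exists_exit {W K : Set V} {x y : V} {l : List D} (h : G.WalkIn W x l y)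
    (hx : x ∈ K) (hy : y ∉ K) : ∃ d ∈ l, G.src d ∈ K ∧ G.tgt d ∉ K := by
  induction l generalizing x with
  | nil => exact absurd (h.2 ▸ hx) hy
  | cons d l ih =>
    obtain ⟨-, rfl, h⟩ := h
    by_cases hd : G.tgt d ∈ K
    · obtain ⟨e, he, h1⟩ := ih h hd
      exact ⟨e, List.mem_cons_of_mem _ he, h1⟩
    · exact ⟨d, List.mem_cons_self .., hx, hd⟩

namespace Run

variable {I K : Set V} (h : G.Run I K) (hA : G.IsArrangement)
include h hA

/-- As long as there are unknown vertices in a convex set that contains the known ones, the method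
can be continued inside this set. -/
lemma exists_isOrangeEnclosing {W : Set V} (hW : G.IsConvex W) (hKW : K ⊆ W) (hne : K ≠ W) :
    ∃ d, G.IsOrangeEnclosing K d ∧ G.tgt d ∈ W := by
  obtain ⟨x, hx⟩ := h.nonempty
  obtain ⟨z, hzW, hzK⟩ := Set.exists_of_ssubset (hKW.ssubset_of_ne hne)
  obtain ⟨l, hl⟩ := hW.exists_walkIn x (hKW hx) z hzW
  obtain ⟨d, hd, h1, h2⟩ := hl.exists_exit hx hzK
  exact ⟨d, (h.isConvex hA).isOrangeEnclosing hA h1 h2, (hl.green hd).2⟩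

/-- Each further step inside `W` enlarges the known set until it is `W`. This embeds the initial
vertices of a partial run in those of a run that fills `W`. -/
lemma exists_run_superset {W : Set V} (hW : G.IsConvex W) (hKW : K ⊆ W) (hf : W.Finite) :
    ∃ J, I ⊆ J ∧ G.Run J W := by
  obtain ⟨n, hn⟩ : ∃ n, n = (W \ K).ncard := ⟨_, rfl⟩
  induction n using Nat.strong_induction_on generalizing I K with
  | _ n ih =>
  subst hn
  by_cases hne : K = W
  · exact ⟨I, subset_rfl, hne ▸ h⟩
  · obtain ⟨d, hd, hdW⟩ := h.exists_isOrangeEnclosing hA hW hKW hne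
    have hsub : G.closure (insert (G.tgt d) K) ⊆ W :=
      hW.quadClosed.closure_subset (Set.insert_subset hdW hKW)
    have hlt : (W \ G.closure (insert (G.tgt d) K)).ncard < (W \ K).ncard := by
      refine Set.ncard_lt_ncard ⟨Set.sdiff_subset_sdiff_right
        ((Set.subset_insert _ _).trans (subset_closure _)), fun h1 => ?_⟩ (hf.subset
          Set.sdiff_subset)
      exact (h1 ⟨hdW, hd.2.1⟩).2 (subset_closure _ (Or.inl rfl))
    obtain ⟨J, hJ, hr⟩ := ih _ hlt (Run.step d h hd) hsub rfl
    exact ⟨J, (Set.subset_insert _ _).trans hJ, hr⟩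

/-- The method can be continued along a geodesic that crosses no green strip. -/
lemma exists_run_of_isGeodesic {x y : V} {l : List D} (hx : x ∈ K) (hl : G.IsGeodesic x l y)
    (hd : ∀ d ∈ l, G.strip d ∉ G.greenStrips K) :
    ∃ L, G.Run (I ∪ {z | ∃ d ∈ l, z = G.tgt d}) L ∧
      G.greenStrips L = G.greenStrips K ∪ {S | ∃ d ∈ l, S = G.strip d} := by
  induction l generalizing x I K with
  | nil => exact ⟨K, by simpa using h, by simp⟩
  | cons d l ih =>
    obtain ⟨⟨rfl, hl1⟩, hl2⟩ := hl
    rw [List.map_cons, List.nodup_cons] at hl2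
    have hK := h.isConvex hA
    have hd0 := hd d (List.mem_cons_self ..)
    have ho : G.IsOrangeEnclosing K d :=
      hK.isOrangeEnclosing hA hx fun h1 => hd0 ⟨d, rfl, hx, h1⟩
    have hg := hA.greenStrips_closure_insert hK hx
    obtain ⟨L, hL, hLg⟩ := ih (Run.step d h ho) (subset_closure _ (Or.inl rfl)) ⟨hl1, hl2.2⟩ (by
      intro e he h1
      change G.strip e ∈ G.greenStrips (G.closure (insert (G.tgt d) K)) at h1
      rw [hg] at h1
      rcases h1 with h1 | h1
      · exact hl2.1 (h1 ▸ List.mem_map_of_mem he)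
      · exact hd e (List.mem_cons_of_mem _ he) h1)
    refine ⟨L, ?_, ?_⟩
    · convert hL using 1
      ext z
      simp only [Set.mem_union, Set.mem_ofPred_eq, List.mem_cons, exists_eq_or_imp,
        Set.mem_insert_iff, src_rev]
      tauto
    · rw [hLg]
      change G.greenStrips (G.closure (insert (G.tgt d) K)) ∪ _ = _
      rw [hg]
      ext z
      simp only [Set.mem_union, Set.mem_ofPred_eq, List.mem_cons, exists_eq_or_imp,
        Set.mem_insert_iff]
      tauto

end Run

lemma isConvex_univ : G.IsConvex (Set.univ : Set V) := by
  refine ⟨fun _ _ _ _ _ => trivial, fun x _ y _ => ?_⟩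
  obtain ⟨l, hl⟩ := G.exists_isWalk x y
  exact ⟨l, WalkIn.of_tgt_mem hl trivial fun _ _ => trivial⟩

lemma greenStrips_univ : G.greenStrips (Set.univ : Set V) = Set.univ := by
  rw [Set.eq_univ_iff_forall]
  intro S
  obtain ⟨d, rfl⟩ := Quotient.exists_rep S
  exact ⟨d, rfl, trivial, trivial⟩

namespace Run

variable {I K : Set V} (h : G.Run I K) (hA : G.IsArrangement)
include h hA

lemma ncard_eq [Finite D] : I.ncard = (G.greenStrips K).ncard + 1 := by
  have : Finite G.Strip := inferInstanceAs (Finite (Quotient _))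
  have := h.encard_eq hA
  rw [← Set.Finite.cast_ncard_eq h.finite, ← Set.Finite.cast_ncard_eq (Set.toFinite _)] at this
  exact_mod_cast this

lemma ncard_le [Finite D] : I.ncard ≤ Nat.card G.Strip + 1 := by
  have : Finite G.Strip := inferInstanceAs (Finite (Quotient _))
  rw [h.ncard_eq hA]
  exact Nat.succ_le_succ (Set.ncard_le_card _)

lemma exists_isOrangeEnclosing_of_ncard_lt [Finite D] (hI : I.ncard < Nat.card G.Strip + 1) :
    ∃ d, G.IsOrangeEnclosing K d := by
  by_cases hK : K = Set.univ
  · rw [h.ncard_eq hA, hK, greenStrips_univ, Set.ncard_univ] at hI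
    exact absurd hI (lt_irrefl _)
  · obtain ⟨d, hd, -⟩ := h.exists_isOrangeEnclosing hA isConvex_univ (Set.subset_univ _) hK
    exact ⟨d, hd⟩

/-- By counting, all strips are green, whereas an unknown vertex would yield an orange enclosing
piece. -/
lemma eq_univ [Finite D] (hI : I.ncard = Nat.card G.Strip + 1) : K = Set.univ := by
  have : Finite G.Strip := inferInstanceAs (Finite (Quotient _))
  by_contra hK
  obtain ⟨d, hd, -⟩ := h.exists_isOrangeEnclosing hA isConvex_univ (Set.subset_univ _) hK
  have h1 : (G.greenStrips K) = Set.univ := by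
    apply Set.eq_of_subset_of_ncard_le (Set.subset_univ _)
    rw [Set.ncard_univ]
    have := h.ncard_eq hA
    omega
  obtain ⟨e, he, hg⟩ : G.strip d ∈ G.greenStrips K := h1 ▸ trivial
  exact hd.2.2 e he hg

end Run

end QuadGraph

/-! ### Zeros of irreducible polynomials and the matroid of algebraic independence -/

open MvPolynomial in
/-- A polynomial of degree one in `X x` is an affine function of `X x`. -/
lemma MvPolynomial.exists_eq_X_mul_add_of_degreeOf_eq_one {σ k : Type*} [Field k]
    {p : MvPolynomial σ k} {x : σ} (hx : p.degreeOf x = 1) :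
    ∃ A ∈ supported k ((p.vars : Set σ) \ {x}), ∃ B ∈ supported k ((p.vars : Set σ) \ {x}),
      A ≠ 0 ∧ p = X x * A + B := by
  have hB : p.modMonomial (Finsupp.single x 1) ∈ supported k ((p.vars : Set σ) \ {x}) := by
    rw [mem_supported]
    intro y hy
    obtain ⟨m, hm, hym⟩ := (mem_vars_iff_mem_support y).1 hy
    rw [mem_support_iff] at hm
    have hle : ¬ Finsupp.single x 1 ≤ m := fun h => hm (coeff_modMonomial_of_le _ h)
    rw [coeff_modMonomial_of_not_le _ hle] at hm
    refine ⟨(mem_vars_iff_mem_support y).2 ⟨m, mem_support_iff.2 hm, hym⟩, ?_⟩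
    rintro rfl
    apply hle
    rw [Finsupp.single_le_iff]
    exact Nat.one_le_iff_ne_zero.2 (Finsupp.mem_support_iff.1 hym)
  refine ⟨p.divMonomial (Finsupp.single x 1), ?_, _, hB, fun h0 => ?_,
    (divMonomial_add_modMonomial_single p x).symm⟩
  · rw [mem_supported]
    intro y hy
    obtain ⟨m, hm, hym⟩ := (mem_vars_iff_mem_support y).1 hy
    rw [mem_support_iff, coeff_divMonomial, ← mem_support_iff] at hm
    have hy0 := Finsupp.mem_support_iff.1 hym
    refine ⟨(mem_vars_iff_mem_support y).2 ⟨_, hm, ?_⟩, ?_⟩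
    · rw [Finsupp.mem_support_iff, Finsupp.add_apply]
      omega
    · rintro rfl
      have := monomial_le_degreeOf y hm
      rw [hx, Finsupp.add_apply, Finsupp.single_eq_same] at this
      omega
  · have h := divMonomial_add_modMonomial_single p x
    rw [h0, mul_zero, zero_add] at h
    rw [h, mem_supported] at hB
    have hxp : x ∈ p.vars := mem_vars_iff_degreeOf_ne_zero.2 (by rw [hx]; exact one_ne_zero)
    exact (hB hxp).2 rfl

section Irreducible

open MvPolynomial

variable {σ : Type u} {k : Type v} {L : Type w} [Field k] [Field L] [Algebra k L]

lemma MvPolynomial.aeval_eq_of_eqOn {s : Set σ} {f g : σ → L} (h : Set.EqOn f g s)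
    {Q : MvPolynomial σ k} (hQ : Q ∈ supported k s) : aeval f Q = aeval g Q := by
  rw [mem_supported] at hQ
  exact eval₂Hom_congr' rfl (fun i hi _ => h (hQ hi)) rfl

lemma AlgebraicIndepOn.eq_zero {f : σ → L} {s : Set σ} (h : AlgebraicIndepOn k f s)
    {Q : MvPolynomial σ k} (hQ : Q ∈ supported k s) (h0 : aeval f Q = 0) : Q = 0 :=
  algebraicIndependent_comp_subtype.1 h Q hQ h0

lemma AlgebraicIndepOn.congr {f g : σ → L} {s : Set σ} (h : AlgebraicIndepOn k f s)
    (hfg : Set.EqOn f g s) : AlgebraicIndepOn k g s := by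
  have : (fun i : s => g i) = fun i : s => f i := funext fun i => (hfg i.2).symm
  unfold AlgebraicIndepOn
  rw [this]
  exact h

variable {p : MvPolynomial σ k} {f : σ → L} {x : σ}

/-- The equation is affine in the value at `x`, and its leading coefficient, a nonzero polynomial in
independent values, does not vanish. -/
lemma MvPolynomial.exists_aeval_update_eq_zero [DecidableEq σ] (hx : p.degreeOf x = 1)
    (hf : AlgebraicIndepOn k f ((p.vars : Set σ) \ {x})) :
    ∃ c, aeval (Function.update f x c) p = 0 := by
  obtain ⟨A, hA, B, hB, hA0, hp⟩ := exists_eq_X_mul_add_of_degreeOf_eq_one hx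
  have hA1 : aeval f A ≠ 0 := fun h => hA0 (hf.eq_zero hA h)
  have he : ∀ c, Set.EqOn (Function.update f x c) f ((p.vars : Set σ) \ {x}) :=
    fun c y hy => Function.update_of_ne hy.2 _ _
  refine ⟨-aeval f B / aeval f A, ?_⟩
  have key : ∀ c, aeval (Function.update f x c) p = c * aeval f A + aeval f B := by
    intro c
    have h1 : aeval (Function.update f x c) p =
        aeval (Function.update f x c) (X x * A + B) := congrArg _ hp
    rw [h1, map_add, map_mul, aeval_X, Function.update_self, aeval_eq_of_eqOn (he c) hA,
      aeval_eq_of_eqOn (he c) hB]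
  rw [key, div_mul_cancel₀ _ hA1, neg_add_cancel]

/-- If all but one of the arguments are algebraically independent, the relations between the
arguments at a zero of an irreducible polynomial are its multiples. -/
lemma MvPolynomial.dvd_of_aeval_eq_zero (hp : Irreducible p) (hx : p.degreeOf x = 1)
    (hf : AlgebraicIndepOn k f ((p.vars : Set σ) \ {x})) (h0 : aeval f p = 0)
    {Q : MvPolynomial σ k} (hQ : Q ∈ supported k (p.vars : Set σ)) (hQ0 : aeval f Q = 0) :
    p ∣ Q := by
  obtain ⟨A, hA, B, hB, hA0, hpAB⟩ := exists_eq_X_mul_add_of_degreeOf_eq_one hx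
  -- Pseudo-division by `p` with respect to `X x`: modulo `p`, `X x * A` may be replaced by `-B`, at
  -- the cost of a power of `A`.
  have key : ∃ (n : ℕ) (S : MvPolynomial σ k), ∃ R ∈ supported k ((p.vars : Set σ) \ {x}),
      A ^ n * Q = p * S + R := by
    refine Algebra.adjoin_induction (p := fun Q _ => ∃ (n : ℕ) (S : MvPolynomial σ k),
      ∃ R ∈ supported k ((p.vars : Set σ) \ {x}), A ^ n * Q = p * S + R) ?_ ?_ ?_ ?_ hQ
    · rintro _ ⟨y, hy, rfl⟩
      by_cases hyx : y = x
      · subst hyx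
        refine ⟨1, 1, -B, neg_mem hB, ?_⟩
        linear_combination -hpAB
      · exact ⟨0, 0, X y, X_mem_supported.2 ⟨hy, hyx⟩, by ring⟩
    · intro r
      exact ⟨0, 0, algebraMap _ _ r, Subalgebra.algebraMap_mem _ r, by ring⟩
    · rintro P Q - - ⟨n, S, R, hR, h⟩ ⟨m, S', R', hR', h'⟩
      refine ⟨n + m, A ^ m * S + A ^ n * S', A ^ m * R + A ^ n * R',
        add_mem (mul_mem (pow_mem hA m) hR) (mul_mem (pow_mem hA n) hR'), ?_⟩
      rw [pow_add]
      linear_combination A ^ m * h + A ^ n * h'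
    · rintro P Q - - ⟨n, S, R, hR, h⟩ ⟨m, S', R', hR', h'⟩
      refine ⟨n + m, S * (A ^ m * Q) + R * S', R * R', mul_mem hR hR', ?_⟩
      rw [pow_add]
      linear_combination A ^ m * Q * h + R * h'
  obtain ⟨n, S, R, hR, h⟩ := key
  have hR0 : R = 0 := by
    apply hf.eq_zero hR
    have := congrArg (aeval f) h
    rw [map_mul, map_add, map_mul, hQ0, h0, mul_zero, zero_mul, zero_add] at this
    exact this.symm
  rw [hR0, add_zero] at h
  have hprime : Prime p := hp.prime
  rcases hprime.dvd_or_dvd (Dvd.intro _ h.symm) with h1 | h1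
  -- The prime `p` does not divide `A`, because `p` has degree 1 in `x` and `A` does not involve
  -- `x`.
  · exfalso
    obtain ⟨C, hC⟩ := hprime.dvd_of_dvd_pow h1
    have hC0 : C ≠ 0 := fun h => hA0 (by rw [hC, h, mul_zero])
    have h2 := degreeOf_mul_eq (n := x) hp.ne_zero hC0
    rw [← hC, hx] at h2
    have h3 : x ∉ A.vars := fun h => (mem_supported.1 hA h).2 rfl
    rw [mem_vars_iff_degreeOf_ne_zero, not_not] at h3
    omega
  · exact h1

/-- A relation that does not involve `y` would be a multiple of `p`, hence zero, since `p` does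
involve `y`. So at a zero of `p` the omitted argument may be changed from `x` to any other one. -/
lemma MvPolynomial.algebraicIndepOn_of_aeval_eq_zero (hp : Irreducible p) (hx : p.degreeOf x = 1)
    (hf : AlgebraicIndepOn k f ((p.vars : Set σ) \ {x})) (h0 : aeval f p = 0) {y : σ}
    (hy : y ∈ p.vars) : AlgebraicIndepOn k f ((p.vars : Set σ) \ {y}) := by
  refine algebraicIndependent_comp_subtype.2 fun Q hQ hQ0 => ?_
  by_contra hne
  obtain ⟨C, hC⟩ := dvd_of_aeval_eq_zero hp hx hf h0 (supported_mono Set.sdiff_subset hQ) hQ0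
  have hC0 : C ≠ 0 := fun h => hne (by rw [hC, h, mul_zero])
  have h2 := degreeOf_mul_eq (n := y) hp.ne_zero hC0
  rw [← hC] at h2
  have h3 : y ∉ Q.vars := fun h => (mem_supported.1 hQ h).2 rfl
  rw [mem_vars_iff_degreeOf_ne_zero, not_not] at h3
  rw [mem_vars_iff_degreeOf_ne_zero] at hy
  omega

variable (k) in
/-- The matroid of algebraic independence of the values of a function. -/
noncomputable def valueMatroid (f : σ → L) : Matroid σ :=
  (AlgebraicIndependent.matroid k L).comap f

lemma valueMatroid_indep_iff {s : Set σ} :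
    (valueMatroid k f).Indep s ↔ AlgebraicIndepOn k f s := by
  rw [valueMatroid, Matroid.comap_indep_iff, AlgebraicIndependent.matroid_indep_iff]
  constructor
  · rintro ⟨h, hi⟩
    exact (algebraicIndependent_image hi).2 h
  · intro h
    have hi : Set.InjOn f s := fun a ha b hb hab =>
      congrArg Subtype.val (h.injective (a₁ := ⟨a, ha⟩) (a₂ := ⟨b, hb⟩) hab)
    exact ⟨(algebraicIndependent_image hi).1 h, hi⟩

lemma mem_valueMatroid_closure {s : Set σ} : x ∈ (valueMatroid k f).closure s ↔
    f x ∈ (AlgebraicIndependent.matroid k L).closure (f '' s) := by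
  rw [valueMatroid, Matroid.comap_closure_eq]
  rfl

lemma subset_valueMatroid_closure (s : Set σ) : s ⊆ (valueMatroid k f).closure s :=
  Matroid.subset_closure _ _ (Set.subset_univ _)

lemma AlgebraicIndepOn.insert_of_notMem_closure {s : Set σ} (h : AlgebraicIndepOn k f s)
    (hx : x ∉ (valueMatroid k f).closure s) : AlgebraicIndepOn k f (insert x s) := by
  rw [← valueMatroid_indep_iff] at h ⊢
  rw [h.insert_indep_iff]
  exact Or.inl ⟨trivial, hx⟩

lemma mem_valueMatroid_closure_of_not_insert {s : Set σ} (h : AlgebraicIndepOn k f s)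
    (hx : ¬ AlgebraicIndepOn k f (insert x s)) : x ∈ (valueMatroid k f).closure s := by
  by_contra hne
  exact hx (h.insert_of_notMem_closure hne)

/-- The rank of `J` is at least that of `I`, which is at least the size of `J`. This is the exchange
argument that compares different sets of initial vertices. -/
lemma Matroid.indep_of_subset_closure {α : Type*} {M : Matroid α} {I J : Set α} (hI : M.Indep I)
    (hJ : J.Finite) (hIJ : I ⊆ M.closure J) (hc : J.encard ≤ I.encard) : M.Indep J := by
  rw [Matroid.indep_iff_eRk_eq_encard_of_finite hJ]
  refine le_antisymm (M.eRk_le_encard J) (hc.trans ?_)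
  rw [← hI.eRk_eq_encard, ← M.eRk_closure_eq J]
  exact M.eRk_mono hIJ

lemma AlgebraicIndepOn.of_subset_closure {I J : Set σ} (hI : AlgebraicIndepOn k f I)
    (hJ : J.Finite) (hIJ : I ⊆ (valueMatroid k f).closure J) (hc : J.encard ≤ I.encard) :
    AlgebraicIndepOn k f J := by
  rw [← valueMatroid_indep_iff] at hI ⊢
  exact Matroid.indep_of_subset_closure hI hJ hIJ hc

/-- At a zero of an irreducible polynomial, each argument is algebraic over the others. -/
lemma MvPolynomial.mem_closure_of_aeval_eq_zero (hp : p ≠ 0) (h0 : aeval f p = 0) {y : σ}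
    (hy : y ∈ p.vars) (hf : AlgebraicIndepOn k f ((p.vars : Set σ) \ {y})) :
    y ∈ (valueMatroid k f).closure ((p.vars : Set σ) \ {y}) := by
  refine mem_valueMatroid_closure_of_not_insert hf fun h => hp ?_
  rw [Set.insert_sdiff_singleton, Set.insert_eq_of_mem (by exact hy)] at h
  exact h.eq_zero (mem_supported.2 subset_rfl) h0

end Irreducible

/-! ### Generic values on a single quad -/

namespace QuadGraph

variable {V : Type u} {D : Type v} {G : QuadGraph V D} {k : Type w} [Field k]

namespace Relations

open MvPolynomial

variable (E : G.Relations k) {L : Type*} [Field L] [Algebra k L]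

/-- `f` satisfies the relation on the quad to the left of `d`, and any three of the values of `f`
at its vertices are algebraically independent. -/
def IsGenericAt (f : V → L) (d : D) : Prop :=
  aeval f (E.rel d) = 0 ∧ ∀ y ∈ G.corners d, AlgebraicIndepOn k f (G.corners d \ {y})

/-- `f` is a solution on the quads with vertices in `W`, and it is generic there. -/
def IsGenericOn (f : V → L) (W : Set V) : Prop :=
  ∀ d, d ∉ G.hole → G.corners d ⊆ W → E.IsGenericAt f d

variable {E} {f g : V → L} {d : D} {W : Set V}

lemma IsGenericAt.congr (h : E.IsGenericAt f d) (hd : d ∉ G.hole)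
    (hfg : Set.EqOn f g (G.corners d)) : E.IsGenericAt g d := by
  refine ⟨?_, fun y hy => (h.2 y hy).congr (hfg.mono Set.sdiff_subset)⟩
  rw [← h.1]
  refine (aeval_eq_of_eqOn hfg ?_).symm
  rw [mem_supported, E.vars_rel d hd]

lemma IsGenericAt.mem_closure (h : E.IsGenericAt f d) (hd : d ∉ G.hole) {y : V}
    (hy : y ∈ G.corners d) : y ∈ (valueMatroid k f).closure (G.corners d \ {y}) := by
  have h2 := h.2 y hy
  rw [← E.vars_rel d hd] at hy h2 ⊢
  exact mem_closure_of_aeval_eq_zero (E.irreducible_rel d hd).ne_zero h.1 hy h2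

-- Three independent values determine a fourth for which every triple is again independent; this is
-- where irreducibility of the relation enters.
open Classical in
lemma exists_isGenericAt_update (hd : d ∉ G.hole) {x : V} (hx : x ∈ G.corners d)
    (hf : AlgebraicIndepOn k f (G.corners d \ {x})) :
    ∃ c, E.IsGenericAt (Function.update f x c) d := by
  have hdeg := E.degreeOf_rel d hd x hx
  rw [← E.vars_rel d hd] at hf
  obtain ⟨c, hc⟩ := exists_aeval_update_eq_zero hdeg hf
  have hf' : AlgebraicIndepOn k (Function.update f x c) (((E.rel d).vars : Set V) \ {x}) :=
    hf.congr fun y hy => (Function.update_of_ne hy.2 _ _).symm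
  refine ⟨c, hc, fun y hy => ?_⟩
  rw [← E.vars_rel d hd] at hy ⊢
  exact algebraicIndepOn_of_aeval_eq_zero (E.irreducible_rel d hd) hdeg hf' hc hy

end Relations

lemma corners_next {d : D} (hd : d ∉ G.hole) : G.corners (G.next d) = G.corners d := by
  ext x
  simp only [corners, next_four hd, Set.mem_insert_iff, Set.mem_singleton_iff]
  tauto

lemma Relations.IsGenericAt.of_next {E : G.Relations k} {L : Type*} [Field L] [Algebra k L]
    {f : V → L} {d : D} (hd : d ∉ G.hole) (h : E.IsGenericAt f (G.next d)) :
    E.IsGenericAt f d := by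
  rw [IsGenericAt, corners_next hd, E.rel_next d hd] at h
  exact h

end QuadGraph

namespace QuadGraph

variable {V : Type u} {D : Type v} {G : QuadGraph V D}

/-! ### The part of a strip inside a convex set -/

lemma Reach.isGeodesic_right (hA : G.IsArrangement) {n : ℕ} {a b : D} (h : G.Reach n a b) :
    G.IsGeodesic (G.tgt a) ((List.range n).map fun k => G.next (G.across^[k] a)) (G.tgt b) := by
  refine ⟨?_, by rw [List.map_map]; exact h.nodup_strips hA⟩
  induction n generalizing b with
  | zero =>
    obtain ⟨-, rfl⟩ := h
    rfl
  | succ n ih =>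
    obtain ⟨h1, h2⟩ := h.split
    obtain rfl : G.across (G.across^[n] a) = b := h2.2
    rw [List.range_succ, List.map_append, isWalk_append]
    refine ⟨_, ih h1, src_next_eq _, ?_⟩
    rw [tgt_across]
    exact (src_next_eq _).symm

lemma Reach.isGeodesic_left (hA : G.IsArrangement) {n : ℕ} {a b : D} (h : G.Reach n a b) :
    G.IsGeodesic (G.src a)
      ((List.range n).map fun k => G.rev (G.next (G.next (G.next (G.across^[k] a)))))
      (G.src b) := by
  constructor
  · induction n generalizing b with
    | zero =>
      obtain ⟨-, rfl⟩ := h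
      rfl
    | succ n ih =>
      obtain ⟨h1, h2⟩ := h.split
      obtain rfl : G.across (G.across^[n] a) = b := h2.2
      have hm : G.across^[n] a ∉ G.hole := h2.1 0 one_pos
      rw [List.range_succ, List.map_append, isWalk_append]
      refine ⟨_, ih h1, ?_, ?_⟩
      · rw [src_rev, tgt_next_three hm]
      · rw [src_across, G.rev_rev]
        rfl
  · have := h.nodup_strips hA
    rw [List.map_map]
    convert this using 1
    refine List.map_congr_left fun i hi => ?_
    rw [Function.comp_apply, strip_rev, strip_next_three (h.1 i (List.mem_range.1 hi))]

lemma iterate_across_succ (n : ℕ) (a : D) : G.across^[n + 1] a = G.across (G.across^[n] a) :=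
  Function.iterate_succ_apply' _ _ _

/-- Each side of a stretch of a strip consists of the initial vertices of a run. The green strips
are the same for both sides, so the two sides have equally many vertices. -/
lemma Reach.exists_run_right (hA : G.IsArrangement) {n : ℕ} {a b : D} (h : G.Reach n a b) :
    ∃ L, G.Run ((fun i => G.tgt (G.across^[i] a)) '' Set.Iic n) L ∧
      G.greenStrips L = {S | ∃ i < n, S = G.strip (G.next (G.across^[i] a))} := by
  obtain ⟨L, hL, hg⟩ := (Run.start (G := G) (G.tgt a)).exists_run_of_isGeodesic hA rfl
    (h.isGeodesic_right hA) (by simp [hA.greenStrips_singleton])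
  refine ⟨L, ?_, ?_⟩
  · convert hL using 1
    ext z
    simp only [Set.mem_image, Set.mem_Iic, Set.mem_union, Set.mem_singleton_iff,
      Set.mem_ofPred_eq, List.mem_map, List.mem_range, exists_exists_and_eq_and]
    constructor
    · rintro ⟨i, hi, rfl⟩
      rcases Nat.eq_zero_or_pos i with rfl | h0
      · exact Or.inl rfl
      · obtain ⟨j, rfl⟩ := Nat.exists_eq_succ_of_ne_zero h0.ne'
        refine Or.inr ⟨j, hi, ?_⟩
        rw [Nat.succ_eq_add_one, iterate_across_succ, tgt_across, src_next_eq]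
    · rintro (rfl | ⟨i, hi, rfl⟩)
      · exact ⟨0, Nat.zero_le _, rfl⟩
      · refine ⟨i + 1, hi, ?_⟩
        rw [iterate_across_succ, tgt_across, src_next_eq]
  · rw [hg, hA.greenStrips_singleton, Set.empty_union]
    simp

lemma Reach.exists_run_left (hA : G.IsArrangement) {n : ℕ} {a b : D} (h : G.Reach n a b) :
    ∃ L, G.Run ((fun i => G.src (G.across^[i] a)) '' Set.Iic n) L ∧
      G.greenStrips L = {S | ∃ i < n, S = G.strip (G.next (G.across^[i] a))} := by
  obtain ⟨L, hL, hg⟩ := (Run.start (G := G) (G.src a)).exists_run_of_isGeodesic hA rfl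
    (h.isGeodesic_left hA) (by simp [hA.greenStrips_singleton])
  refine ⟨L, ?_, ?_⟩
  · convert hL using 1
    ext z
    simp only [Set.mem_image, Set.mem_Iic, Set.mem_union, Set.mem_singleton_iff,
      Set.mem_ofPred_eq, List.mem_map, List.mem_range, exists_exists_and_eq_and, tgt_rev]
    constructor
    · rintro ⟨i, hi, rfl⟩
      rcases Nat.eq_zero_or_pos i with rfl | h0
      · exact Or.inl rfl
      · obtain ⟨j, rfl⟩ := Nat.exists_eq_succ_of_ne_zero h0.ne'
        refine Or.inr ⟨j, hi, ?_⟩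
        rw [Nat.succ_eq_add_one, iterate_across_succ, src_across]
    · rintro (rfl | ⟨i, hi, rfl⟩)
      · exact ⟨0, Nat.zero_le _, rfl⟩
      · refine ⟨i + 1, hi, ?_⟩
        rw [iterate_across_succ, src_across]
  · rw [hg, hA.greenStrips_singleton, Set.empty_union]
    ext S
    simp only [Set.mem_ofPred_eq, List.mem_map, List.mem_range, exists_exists_and_eq_and]
    refine exists_congr fun i => and_congr_right fun hi => ?_
    rw [strip_rev, strip_next_three (h.1 i hi)]

lemma Reach.tgt_injOn (hA : G.IsArrangement) {n : ℕ} {a b : D} (h : G.Reach n a b) :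
    Set.InjOn (fun i => G.tgt (G.across^[i] a)) (Set.Iic n) := by
  have key : ∀ i j, i < j → j ≤ n → G.tgt (G.across^[i] a) ≠ G.tgt (G.across^[j] a) := by
    intro i j hij hj he
    obtain ⟨k, rfl⟩ := Nat.exists_eq_add_of_lt hij
    have h1 : G.Reach (i + (k + 1)) a (G.across^[i + k + 1] a) :=
      ⟨fun m hm => h.1 m (by omega), rfl⟩
    have h2 := h1.split.2.isGeodesic_right hA
    rw [← he] at h2
    simpa using hA.eq_nil_of_isGeodesic h2
  intro i hi j hj hij
  by_contra hne
  rcases Nat.lt_or_gt_of_ne hne with h1 | h1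
  · exact key i j h1 hj hij
  · exact key j i h1 hi hij.symm

variable (G) in
/-- The edges `a, across a, …, across^[n] a` are all the edges in `W` that belong to the strip
through `d`, with the orientation of `d`. -/
structure IsStripIn (W : Set V) (d a : D) (n : ℕ) : Prop where
  notMem_hole : ∀ i < n, G.across^[i] a ∉ G.hole
  src_mem : ∀ i ≤ n, G.src (G.across^[i] a) ∈ W
  tgt_mem : ∀ i ≤ n, G.tgt (G.across^[i] a) ∈ W
  aligned : ∀ i ≤ n, G.Aligned d (G.across^[i] a)
  exists_eq : ∀ f, G.Aligned d f → G.src f ∈ W → G.tgt f ∈ W → ∃ i ≤ n, G.across^[i] a = f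
  lt_of_mem : ∀ i ≤ n, G.across^[i] a ∉ G.hole → G.src (G.across (G.across^[i] a)) ∈ W →
    G.tgt (G.across (G.across^[i] a)) ∈ W → i < n

lemma IsConvex.exists_isStripIn [Finite D] {W : Set V} (hW : G.IsConvex W)
    (hA : G.IsArrangement) {d : D} (hd : G.src d ∈ W) (hd' : G.tgt d ∈ W) :
    ∃ a n, G.IsStripIn W d a n := by
  classical
  have : Finite G.Strip := inferInstanceAs (Finite (Quotient _))
  have : Fintype G.Strip := Fintype.ofFinite _
  -- A longest stretch with both end edges in `W` is chosen. It exists because the strips crossed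
  -- are distinct, so that the length is at most the number of strips. Convexity puts the edges in
  -- between into `W`.
  let P : ℕ → Prop := fun n => ∃ a b, G.Reach n a b ∧ G.Aligned d a ∧ G.src a ∈ W ∧
    G.tgt a ∈ W ∧ G.src b ∈ W ∧ G.tgt b ∈ W
  have hP0 : P 0 := ⟨d, d, reach_zero d, Aligned.refl d, hd, hd', hd, hd'⟩
  have hPb : ∀ m, P m → m ≤ Fintype.card G.Strip := by
    rintro m ⟨a, b, h, -⟩
    have := (h.nodup_strips hA).length_le_card
    simpa using this
  obtain ⟨n, hn, hmax⟩ : ∃ n, P n ∧ ∀ m, P m → m ≤ n :=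
    ⟨_, Nat.findGreatest_spec (Nat.zero_le _) hP0, fun m hm => Nat.le_findGreatest (hPb m hm) hm⟩
  obtain ⟨a, b, h, hal, ha, ha', hb, hb'⟩ := hn
  have hreach : ∀ i ≤ n, G.Reach i a (G.across^[i] a) := fun i hi =>
    ⟨fun m hm => h.1 m (by omega), rfl⟩
  refine ⟨a, n, h.1, ?_, ?_, fun i hi => hal.trans ⟨i, Or.inl (hreach i hi)⟩, ?_, ?_⟩
  · intro i hi
    rcases hi.lt_or_eq with hi | rfl
    · have h1 := (hW.walkIn hA ha hb (h.isGeodesic_left hA)).green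
        (List.mem_map_of_mem (List.mem_range.2 hi))
      rw [src_rev, tgt_next_three (h.1 i hi)] at h1
      exact h1.1
    · rw [h.2]; exact hb
  · intro i hi
    rcases hi.lt_or_eq with hi | rfl
    · have h1 := (hW.walkIn hA ha' hb' (h.isGeodesic_right hA)).green
        (List.mem_map_of_mem (List.mem_range.2 hi))
      rw [src_next_eq] at h1
      exact h1.1
    · rw [h.2]; exact hb'
  · intro f hf h1 h2
    obtain ⟨m, hm | hm⟩ := hal.symm.trans hf
    · exact ⟨m, hmax m ⟨a, f, hm, hal, ha, ha', h1, h2⟩, hm.2⟩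
    · have h3 := hmax (m + n) ⟨f, b, hm.trans h, hf, h1, h2, hb, hb'⟩
      obtain rfl : m = 0 := by omega
      exact ⟨0, Nat.zero_le _, hm.2.symm⟩
  · intro i hi h1 h2 h3
    have h4 := hmax (i + 1) ⟨a, _, (hreach i hi).trans (reach_one h1), hal, ha, ha', h2, h3⟩
    omega

/-! ### One step of the construction -/

lemma WalkIn.inter_side (hA : G.IsArrangement) {T : G.Strip} {W : Set V} {x y : V} {l : List D}
    (h : G.WalkIn W x l y) (hT : T ∉ l.map G.strip) :
    G.WalkIn (W ∩ {v | hA.side T v = hA.side T x}) x l y := by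
  induction l generalizing x with
  | nil => exact ⟨⟨h.1, rfl⟩, h.2⟩
  | cons d l ih =>
    obtain ⟨hx, rfl, h⟩ := h
    rw [List.map_cons, List.mem_cons, not_or] at hT
    have := ih h hT.2
    rw [hA.side_tgt_eq fun h => hT.1 h.symm] at this
    exact ⟨⟨hx, rfl⟩, rfl, this⟩

lemma Ladder.exists_rung {K : Set V} {d e : D} {σ σ' : List D} (h : G.Ladder d σ σ' e)
    (hd : G.src d ∈ K) (he : G.src e ∉ K) : ∃ d₁ d₂ a a', G.Rung d₁ d₂ a a' ∧ a ∈ σ ∧ a' ∈ σ' ∧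
      G.src d₁ ∈ K ∧ G.src d₂ ∉ K ∧ G.strip d₁ = G.strip d := by
  induction h with
  | nil => exact absurd hd he
  | @cons d d₁ a a' e σ σ' h h' ih =>
    by_cases h1 : G.src d₁ ∈ K
    · obtain ⟨f, f', b, b', h2, hb, hb', h3, h4, h5⟩ := ih h1 he
      exact ⟨f, f', b, b', h2, List.mem_cons_of_mem _ hb, List.mem_cons_of_mem _ hb', h3, h4,
        h5.trans h.strip_eq⟩
    · exact ⟨d, d₁, a, a', h, List.mem_cons_self .., List.mem_cons_self .., hd, h1, rfl⟩

namespace IsConvex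

variable {K : Set V} (hK : G.IsConvex K) (hA : G.IsArrangement) {d : D}
  (hd : G.IsOrangeEnclosing K d)
include hK hd

/-- The strip of `d` has no green piece, so no walk within `K` crosses it. -/
lemma side_eq_of_mem {x : V} (hx : x ∈ K) :
    hA.side (G.strip d) x = hA.side (G.strip d) (G.src d) := by
  obtain ⟨l, hl⟩ := hK.exists_walkIn _ hd.1 _ hx
  refine hA.side_eq_of_isWalk hl.isWalk fun h => ?_
  obtain ⟨e, he, hed⟩ := List.mem_map.1 h
  exact hd.2.2 e hed (hl.green he)

/-- A new vertex on the near side would be reached from `src d` by a geodesic that leaves `K` across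
a strip other than that of `d`. This strip must already be green in `K`, and then convexity keeps
the geodesic in `K`. -/
lemma mem_iff_side_eq {x : V} (hx : x ∈ G.closure (insert (G.tgt d) K)) :
    x ∈ K ↔ hA.side (G.strip d) x = hA.side (G.strip d) (G.src d) := by
  refine ⟨hK.side_eq_of_mem hA hd, fun hs => ?_⟩
  have hW := hA.isConvex_closure_insert hK hd.1
  obtain ⟨l, hl, hln⟩ :=
    hW.exists_geodesic hA (subset_closure _ (Or.inr hd.1) : G.src d ∈ _) hx
  have hT : G.strip d ∉ l.map G.strip := fun h => (hA.mem_strips_iff ⟨hl.isWalk, hln⟩).1 h hs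
  by_contra hne
  obtain ⟨e, he, h1, h2⟩ := hl.exists_exit hd.1 hne
  have h3 : G.strip e ∈ G.greenStrips (G.closure (insert (G.tgt d) K)) := ⟨e, rfl, hl.green he⟩
  rw [hA.greenStrips_closure_insert hK hd.1] at h3
  rcases h3 with h3 | ⟨f, hf, hg⟩
  · exact hT (h3 ▸ List.mem_map_of_mem he)
  · exact h2 (hK.tgt_mem hA h1 hg.1 hg.2 hf)

include hA in
lemma tgt_mem_iff {f : D} (hf : G.src f ∈ G.closure (insert (G.tgt d) K))
    (hf' : G.tgt f ∈ G.closure (insert (G.tgt d) K)) :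
    (G.src f ∈ K ↔ G.tgt f ∈ K) ↔ G.strip f ≠ G.strip d := by
  rw [hK.mem_iff_side_eq hA hd hf, hK.mem_iff_side_eq hA hd hf']
  by_cases h : G.strip f = G.strip d
  · have h1 := hA.side_tgt_ne f
    rw [h] at h1
    simp only [h, ne_eq, not_true_eq_false, iff_false]
    intro h2
    by_cases h3 : hA.side (G.strip d) (G.src f) = hA.side (G.strip d) (G.src d)
    · exact h1 ((h2.1 h3).trans h3.symm)
    · exact h1 (eq_of_ne_of_ne (fun h => h3 (h2.2 h)) h3)
  · simp [hA.side_tgt_eq h, h]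

-- The new vertices are those of the enlarged set beyond the strip of `d`, and geodesics between
-- vertices on one side do not cross the strip.
include hA in
lemma isConvex_sdiff : G.IsConvex (G.closure (insert (G.tgt d) K) \ K) := by
  have hW := hA.isConvex_closure_insert hK hd.1
  constructor
  · intro q hq h0 h1 h2
    have h3 := hW.quadClosed q hq h0.1 h1.1 h2.1
    refine ⟨h3, fun h4 => ?_⟩
    rw [src_next_eq] at h1
    have e1 := (hK.tgt_mem_iff hA hd h0.1 h1.1).1 (iff_of_false h0.2 h1.2)
    rw [src_next_eq (G.next (G.next q))] at h3 h4
    have e2 := (hK.tgt_mem_iff hA hd h2.1 h3).2 (by rwa [strip_next_next hq])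
    exact h2.2 (e2.2 h4)
  · intro x hx y hy
    obtain ⟨l, hl, hln⟩ := hW.exists_geodesic hA hx.1 hy.1
    have hsx := fun h => hx.2 ((hK.mem_iff_side_eq hA hd hx.1).2 h)
    have hsy := fun h => hy.2 ((hK.mem_iff_side_eq hA hd hy.1).2 h)
    have hT : G.strip d ∉ l.map G.strip := fun h =>
      (hA.mem_strips_iff ⟨hl.isWalk, hln⟩).1 h (eq_of_ne_of_ne hsy hsx)
    refine ⟨l, (hl.inter_side hA hT).mono ?_⟩
    rintro v ⟨hv, hv'⟩
    exact ⟨hv, fun h => hsx (hv'.symm.trans ((hK.mem_iff_side_eq hA hd hv).1 h))⟩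

include hA in
/-- A strip that is green on the far side of the new green strip crosses it between the known
vertices and the new ones. -/
lemma exists_crossing {R : G.Strip}
    (hR : R ∈ G.greenStrips (G.closure (insert (G.tgt d) K) \ K)) :
    ∃ q, q ∉ G.hole ∧ G.strip q = G.strip d ∧ G.strip (G.next q) = R ∧ G.src q ∈ K ∧
      G.tgt q ∈ G.closure (insert (G.tgt d) K) ∧
      G.src (G.across q) ∈ G.closure (insert (G.tgt d) K) ∧
      G.tgt (G.across q) ∈ G.closure (insert (G.tgt d) K) := by
  have hW := hA.isConvex_closure_insert hK hd.1
  obtain ⟨g, rfl, h1, h2⟩ := hR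
  change G.tgt g ∈ _ at h2
  have hg := (hK.tgt_mem_iff hA hd h1.1 h2.1).1 (iff_of_false h1.2 h2.2)
  have h3 : G.strip g ∈ G.greenStrips (G.closure (insert (G.tgt d) K)) :=
    ⟨g, rfl, h1.1, h2.1⟩
  rw [hA.greenStrips_closure_insert hK hd.1] at h3
  obtain ⟨f, hf, hf1, hf2⟩ := h3.resolve_left hg
  change G.tgt f ∈ K at hf2
  have hKW : K ⊆ G.closure (insert (G.tgt d) K) :=
    (Set.subset_insert _ _).trans (subset_closure _)
  obtain ⟨g', hg', hal, h1', h2'⟩ : ∃ g', G.strip g' = G.strip g ∧ G.Aligned f g' ∧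
      G.src g' ∈ G.closure (insert (G.tgt d) K) \ K ∧
      G.tgt g' ∈ G.closure (insert (G.tgt d) K) \ K := by
    rcases aligned_or_aligned_rev hf with h | h
    · exact ⟨g, rfl, h, h1, h2⟩
    · exact ⟨G.rev g, strip_rev g, h, h2, by rwa [tgt_rev]⟩
  obtain ⟨σ, σ', hL, hσ⟩ := hal.exists_ladder hA
  have hw := hW.walkIn hA (hKW hf1) h1'.1 ⟨hL.isWalk_left, hσ⟩
  have hw' := hW.walkIn hA (hKW hf2) h2'.1 ⟨hL.isWalk_right, by rwa [hL.strips_right]⟩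
  -- The rung at which the strip `R` leaves `K`: its side edge joins a known vertex to a new one and
  -- hence lies on the strip of `d`.
  obtain ⟨d₁, d₂, a, a', hr, ha, ha', k1, k2, k3⟩ := hL.exists_rung hf1 h1'.2
  have w1 := hw.green ha
  have w2 := hw'.green ha'
  have haT : G.strip a = G.strip d := by
    by_contra hne
    have := (hK.tgt_mem_iff hA hd w1.1 w1.2).2 hne
    rw [hr.src_left, hr.tgt_left] at this
    exact k2 (this.1 k1)
  rw [hr.src_left, hr.tgt_left] at w1
  rw [hr.src_right, hr.tgt_right] at w2
  have k4 : G.tgt d₁ ∈ K := ((hK.tgt_mem_iff hA hd w1.1 w2.1).2 (by rwa [k3, hf])).1 k1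
  rw [hf] at k3
  -- The quad is turned so that it is seen from its edge on the strip of `d` whose initial vertex is
  -- known.
  cases hr with
  | fwd _ hq =>
    rw [strip_rev, strip_next_three hq] at haT
    refine ⟨G.next d₁, next_notMem hq, haT, by rw [strip_next_next hq, k3], ?_, ?_, ?_, ?_⟩
    · rwa [src_next_eq]
    · have := w2.2
      rwa [tgt_across, src_next_eq] at this
    · rw [src_across, next_four hq]
      exact w1.1
    · rw [tgt_across, ← src_across]
      exact w1.2
  | bwd _ hq =>
    have hn := next_notMem (next_notMem hq)
    rw [strip_across hq] at k3
    refine ⟨G.next (G.next (G.next d₂)), next_notMem hn, haT, by rw [next_four hq, k3], ?_, ?_,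
      ?_, ?_⟩
    · rwa [← src_across]
    · rw [tgt_next_three hq]
      exact w1.2
    · rw [src_across, next_four hn, ← tgt_across]
      exact w2.1
    · rw [tgt_across, next_four hq, src_next_eq]
      exact w2.2

include hA in
lemma exists_eq_of_isStripIn {a : D} {n : ℕ}
    (hc : G.IsStripIn (G.closure (insert (G.tgt d) K)) d a n) {q : D} (hq : q ∉ G.hole)
    (hqT : G.strip q = G.strip d) (h0 : G.src q ∈ K)
    (h1 : G.tgt q ∈ G.closure (insert (G.tgt d) K))
    (h2 : G.src (G.across q) ∈ G.closure (insert (G.tgt d) K))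
    (h3 : G.tgt (G.across q) ∈ G.closure (insert (G.tgt d) K)) :
    ∃ i < n, G.across^[i] a = q := by
  have hal := hA.aligned_of_side_eq hqT (hK.side_eq_of_mem hA hd h0)
  obtain ⟨i, hi, rfl⟩ := hc.exists_eq q hal (subset_closure _ (Or.inr h0)) h1
  exact ⟨i, hc.lt_of_mem i hi hq h2 h3, rfl⟩

include hA in
/-- The quads among the known vertices after a step of the construction. -/
lemma corners_cases {a : D} {n : ℕ}
    (hc : G.IsStripIn (G.closure (insert (G.tgt d) K)) d a n) {q : D} (hq : q ∉ G.hole)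
    (hqW : G.corners q ⊆ G.closure (insert (G.tgt d) K)) :
    G.corners q ⊆ K ∨ G.corners q ⊆ G.closure (insert (G.tgt d) K) \ K ∨
      ∃ i < n, G.across^[i] a = q ∨ G.across^[i] a = G.next q ∨
        G.across^[i] a = G.next (G.next q) ∨ G.across^[i] a = G.next (G.next (G.next q)) := by
  -- On each of the two opposite edges of `q` that lie on the strip, exactly one vertex is in `K`;
  -- the edge whose initial vertex is known has the orientation of `d`.
  have key : ∀ q, q ∉ G.hole → G.corners q ⊆ G.closure (insert (G.tgt d) K) →
      G.strip q = G.strip d →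
      ∃ i < n, G.across^[i] a = q ∨ G.across^[i] a = G.next (G.next q) := by
    intro q hq hqW hqT
    have m0 : G.src q ∈ G.closure (insert (G.tgt d) K) := hqW (by simp [corners])
    have m1 : G.tgt q ∈ G.closure (insert (G.tgt d) K) :=
      src_next_eq q ▸ hqW (by simp [corners])
    have m2 : G.src (G.next (G.next q)) ∈ G.closure (insert (G.tgt d) K) :=
      hqW (by simp [corners])
    have m3 : G.src (G.next (G.next (G.next q))) ∈ G.closure (insert (G.tgt d) K) :=
      hqW (by simp [corners])
    by_cases h0 : G.src q ∈ K
    · obtain ⟨i, hi, h⟩ := hK.exists_eq_of_isStripIn hA hd hc hq hqT h0 m1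
        (by rwa [src_across]) (by rwa [tgt_across])
      exact ⟨i, hi, Or.inl h⟩
    · have e1 := mt (hK.tgt_mem_iff hA hd m0 m1).1 (not_not.2 hqT)
      have h1 : G.tgt q ∈ K := by tauto
      rw [← src_next_eq q] at m1 h1
      rw [src_next_eq (G.next q)] at m2
      have e2 := (hK.tgt_mem_iff hA hd m1 m2).2 (hqT ▸ hA.strip_next_ne q hq)
      have h2 := e2.1 h1
      rw [← src_next_eq (G.next q)] at m2 h2
      obtain ⟨i, hi, h⟩ := hK.exists_eq_of_isStripIn hA hd hc (next_notMem (next_notMem hq))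
        (by rw [strip_next_next hq, hqT]) h2 (by rwa [src_next_eq] at m3)
        (by rwa [src_across, next_four (next_notMem hq)]) (by rwa [tgt_across, next_four hq])
      exact ⟨i, hi, Or.inr h⟩
  have m0 : G.src q ∈ G.closure (insert (G.tgt d) K) := hqW (by simp [corners])
  have m1 : G.src (G.next q) ∈ G.closure (insert (G.tgt d) K) := hqW (by simp [corners])
  have m2 : G.src (G.next (G.next q)) ∈ G.closure (insert (G.tgt d) K) :=
    hqW (by simp [corners])
  have m3 : G.src (G.next (G.next (G.next q))) ∈ G.closure (insert (G.tgt d) K) :=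
    hqW (by simp [corners])
  by_cases h0 : G.strip q = G.strip d
  · obtain ⟨i, hi, h | h⟩ := key q hq hqW h0
    · exact Or.inr (Or.inr ⟨i, hi, Or.inl h⟩)
    · exact Or.inr (Or.inr ⟨i, hi, Or.inr (Or.inr (Or.inl h))⟩)
  by_cases h1 : G.strip (G.next q) = G.strip d
  · obtain ⟨i, hi, h | h⟩ := key _ (next_notMem hq) (by rwa [corners_next hq]) h1
    · exact Or.inr (Or.inr ⟨i, hi, Or.inr (Or.inl h)⟩)
    · exact Or.inr (Or.inr ⟨i, hi, Or.inr (Or.inr (Or.inr h))⟩)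
  have e0 := (hK.tgt_mem_iff hA hd m0 (src_next_eq q ▸ m1)).2 h0
  have e1 := (hK.tgt_mem_iff hA hd m1 (src_next_eq (G.next q) ▸ m2)).2 h1
  have e2 := (hK.tgt_mem_iff hA hd m2 (src_next_eq (G.next (G.next q)) ▸ m3)).2
    (by rwa [strip_next_next hq])
  rw [← src_next_eq] at e0 e1 e2
  by_cases hs : G.src q ∈ K
  · left
    rintro x (rfl | rfl | rfl | rfl)
    exacts [hs, e0.1 hs, e1.1 (e0.1 hs), e2.1 (e1.1 (e0.1 hs))]
  · right; left
    rintro x (rfl | rfl | rfl | rfl)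
    exacts [⟨m0, hs⟩, ⟨m1, fun h => hs (e0.2 h)⟩, ⟨m2, fun h => hs (e0.2 (e1.2 h))⟩,
      ⟨m3, fun h => hs (e0.2 (e1.2 (e2.2 h)))⟩]

include hA in
/-- The new vertices are determined by those next to the new green strip. -/
lemma run_sdiff {a : D} {n : ℕ} (hc : G.IsStripIn (G.closure (insert (G.tgt d) K)) d a n) :
    G.Run ((fun i => G.tgt (G.across^[i] a)) '' Set.Iic n)
      (G.closure (insert (G.tgt d) K) \ K) := by
  have hr : G.Reach n a (G.across^[n] a) := ⟨hc.notMem_hole, rfl⟩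
  obtain ⟨L, hL, hLg⟩ := hr.exists_run_right hA
  have hW' := hK.isConvex_sdiff hA hd
  have hsub : L ⊆ G.closure (insert (G.tgt d) K) \ K := by
    refine hL.subset_of_quadClosed hW'.quadClosed ?_
    rintro _ ⟨i, hi, rfl⟩
    refine ⟨hc.tgt_mem i hi, fun h => ?_⟩
    have h1 := hc.aligned i hi
    have h2 : G.src (G.across^[i] a) ∈ K := (hK.mem_iff_side_eq hA hd (hc.src_mem i hi)).2
      (hA.side_src_eq_of_aligned h1)
    exact (hK.tgt_mem_iff hA hd (hc.src_mem i hi) (hc.tgt_mem i hi)).1 (iff_of_true h2 h)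
      h1.strip_eq.symm
  by_cases hne : L = G.closure (insert (G.tgt d) K) \ K
  · exact hne ▸ hL
  exfalso
  -- An enclosing piece left over inside `W \ K` would lie on a strip that crosses the stretch in
  -- `W`, but all such strips are green in `L`.
  obtain ⟨f, hf, hfW⟩ := hL.exists_isOrangeEnclosing hA hW' hsub hne
  obtain ⟨q, hq, hqT, hqR, h0, h1, h2, h3⟩ :=
    hK.exists_crossing hA hd (R := G.strip f) ⟨f, rfl, hsub hf.1, hfW⟩
  obtain ⟨i, hi, rfl⟩ := hK.exists_eq_of_isStripIn hA hd hc hq hqT h0 h1 h2 h3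
  obtain ⟨e, he, hg⟩ : G.strip f ∈ G.greenStrips L := by
    rw [hLg]
    exact ⟨i, hi, hqR.symm⟩
  exact hf.2.2 e he hg

include hA in
lemma src_mem_of_isStripIn {a : D} {n : ℕ}
    (hc : G.IsStripIn (G.closure (insert (G.tgt d) K)) d a n) {i : ℕ} (hi : i ≤ n) :
    G.src (G.across^[i] a) ∈ K :=
  (hK.mem_iff_side_eq hA hd (hc.src_mem i hi)).2 (hA.side_src_eq_of_aligned (hc.aligned i hi))

include hA in
lemma tgt_notMem_of_isStripIn {a : D} {n : ℕ}
    (hc : G.IsStripIn (G.closure (insert (G.tgt d) K)) d a n) {i : ℕ} (hi : i ≤ n) :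
    G.tgt (G.across^[i] a) ∉ K := fun h =>
  (hK.tgt_mem_iff hA hd (hc.src_mem i hi) (hc.tgt_mem i hi)).1
    (iff_of_true (hK.src_mem_of_isStripIn hA hd hc hi) h) (hc.aligned i hi).strip_eq.symm

end IsConvex

end QuadGraph

namespace QuadGraph

variable {V : Type u} {D : Type v} {G : QuadGraph V D} {k : Type w} [Field k]

/-! ### Generic solutions -/

namespace Relations

variable {E : G.Relations k} {L : Type*} [Field L] [Algebra k L] {f : V → L} {W : Set V}

/-- In a generic solution all values are algebraic over the initial values. -/
lemma IsGenericOn.subset_closure (h : E.IsGenericOn f W) (hA : G.IsArrangement) {J : Set V}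
    (hJ : G.Run J W) : W ⊆ (valueMatroid k f).closure J := by
  have hW := (hJ.isConvex hA).quadClosed
  have key : G.QuadClosed (W ∩ (valueMatroid k f).closure J) := by
    intro d hd h0 h1 h2
    have h3 := hW d hd h0.1 h1.1 h2.1
    refine ⟨h3, ?_⟩
    have hc : G.corners d ⊆ W := by
      rintro x (rfl | rfl | rfl | rfl)
      exacts [h0.1, h1.1, h2.1, h3]
    have h4 := (h d hd hc).mem_closure hd (y := G.src (G.next (G.next (G.next d))))
      (by simp [corners])
    refine Matroid.closure_subset_closure_of_subset_closure ?_ h4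
    rintro x ⟨rfl | rfl | rfl | rfl, hx⟩
    exacts [h0.2, h1.2, h2.2, absurd rfl hx]
  exact (hJ.subset_of_quadClosed key fun x hx =>
    ⟨hJ.subset hx, subset_valueMatroid_closure J hx⟩).trans Set.inter_subset_right

/-- A generic solution is determined by algebraically independent initial values, whatever choices
are made in the construction method. -/
lemma IsGenericOn.algebraicIndepOn (h : E.IsGenericOn f W) (hA : G.IsArrangement) {I J : Set V}
    (hI : G.Run I W) (hf : AlgebraicIndepOn k f I) (hJ : G.Run J W) : AlgebraicIndepOn k f J := by
  refine hf.of_subset_closure hJ.finite (hI.subset.trans (h.subset_closure hA hJ)) ?_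
  rw [hI.encard_eq hA, hJ.encard_eq hA]

/-- A run inside `W` is continued until it fills `W`; its initial vertices form part of an
independent set. -/
lemma IsGenericOn.algebraicIndepOn_of_subset [Finite V] (h : E.IsGenericOn f W)
    (hA : G.IsArrangement) {I J K : Set V} (hI : G.Run I W) (hf : AlgebraicIndepOn k f I)
    (hJ : G.Run J K) (hKW : K ⊆ W) : AlgebraicIndepOn k f J := by
  obtain ⟨J', hJJ', hJ'⟩ := hJ.exists_run_superset hA (hI.isConvex hA) hKW (Set.toFinite _)
  exact (h.algebraicIndepOn hA hI hf hJ').mono hJJ'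

open Classical in
/-- Extending a generic solution to the fourth vertex `t'` of a quad. -/
lemma exists_isGenericAt_update_notMem {q : D} (hq : q ∉ G.hole) {t t' : V} {S : Set V}
    {C : Set L} (hC : (AlgebraicIndependent.matroid k L).closure C = C) (ht' : t' ∈ G.corners q)
    (ht : t ∈ G.corners q) (hne : t ≠ t')
    (h1 : G.corners q \ {t'} = insert t S) (h2 : G.corners q \ {t} = insert t' S)
    (hS : AlgebraicIndepOn k f S) (hSC : ∀ v ∈ S, f v ∈ C) (htC : f t ∉ C) :
    ∃ c, E.IsGenericAt (Function.update f t' c) q ∧ c ∉ C := by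
  have htS : t' ∉ S := fun h => by
    have h' : t' ∈ G.corners q \ {t'} := h1 ▸ Set.mem_insert_of_mem t h
    exact h'.2 rfl
  have hcl : ∀ X : Set L, X ⊆ C → (AlgebraicIndependent.matroid k L).closure X ⊆ C := by
    intro X hX
    rw [← hC]
    exact Matroid.closure_subset_closure _ hX
  have hind : AlgebraicIndepOn k f (G.corners q \ {t'}) := by
    rw [h1]
    refine hS.insert_of_notMem_closure fun h => htC ?_
    rw [mem_valueMatroid_closure] at h
    refine hcl _ ?_ h
    rintro _ ⟨v, hv, rfl⟩
    exact hSC v hv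
  obtain ⟨c, hc⟩ := exists_isGenericAt_update (E := E) hq ht' hind
  -- The value at `t` is algebraic over the other three. If `c` were in the closed set `C`, all
  -- these would lie in `C`, and hence so would the value at `t`.
  refine ⟨c, hc, fun hcC => htC ?_⟩
  have h3 := hc.mem_closure hq ht
  rw [h2, mem_valueMatroid_closure, Function.update_of_ne hne] at h3
  refine hcl _ ?_ h3
  rintro _ ⟨v, rfl | hv, rfl⟩
  · rwa [Function.update_self]
  · rw [Function.update_of_ne (fun h => htS (by rwa [← h]))]
    exact hSC v hv

open Classical in
/-- Extending a generic solution on `K` along a strip. -/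
lemma exists_isGenericAt_along {n : ℕ} {q : ℕ → D} {s t : ℕ → V} {K : Set V} {C : Set L}
    (hC : (AlgebraicIndependent.matroid k L).closure C = C)
    (hq : ∀ i < n, q i ∉ G.hole)
    (hc : ∀ i < n, G.corners (q i) = {s i, t i, t (i + 1), s (i + 1)})
    (hs : ∀ i ≤ n, s i ∈ K) (ht : ∀ i ≤ n, t i ∉ K) (hinj : Set.InjOn t (Set.Iic n))
    (hfC : ∀ v ∈ K, f v ∈ C)
    (hf : ∀ i < n, AlgebraicIndepOn k f {s i, s (i + 1)})
    {m : ℕ} (hm : m ≤ n) {y : L} (hy : y ∉ C) :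
    ∃ g : V → L, Set.EqOn f g K ∧ g (t m) = y ∧ (∀ i ≤ n, g (t i) ∉ C) ∧
      ∀ i < n, E.IsGenericAt g (q i) := by
  have hst : ∀ i ≤ n, ∀ j ≤ n, s i ≠ t j := fun i hi j hj h => ht j hj (h ▸ hs i hi)
  have htt : ∀ i < n, t i ≠ t (i + 1) := fun i hi h => by
    have := hinj (Set.mem_Iic.2 hi.le) (Set.mem_Iic.2 hi) h
    omega
  have hr : ∀ i < n, G.corners (q i) \ {t (i + 1)} = insert (t i) {s i, s (i + 1)} := by
    intro i hi
    rw [hc i hi]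
    ext x
    have h1 := hst i hi.le (i + 1) hi
    have h2 := hst (i + 1) hi (i + 1) hi
    have h3 := htt i hi
    simp only [Set.mem_sdiff, Set.mem_insert_iff, Set.mem_singleton_iff]
    constructor
    · tauto
    · rintro (rfl | rfl | rfl) <;> simp [*]
  have hl : ∀ i < n, G.corners (q i) \ {t i} = insert (t (i + 1)) {s i, s (i + 1)} := by
    intro i hi
    rw [hc i hi]
    ext x
    have h1 := hst i hi.le i hi.le
    have h2 := hst (i + 1) hi i hi.le
    have h3 := htt i hi
    simp only [Set.mem_sdiff, Set.mem_insert_iff, Set.mem_singleton_iff]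
    constructor
    · tauto
    · rintro (rfl | rfl | rfl) <;> simp [*, h3.symm]
  have hcongr : ∀ (g g' : V → L) (j : ℕ), j ≤ n → (∀ v, v ≠ t j → g v = g' v) →
      ∀ i < n, i ≠ j → i + 1 ≠ j → E.IsGenericAt g (q i) → E.IsGenericAt g' (q i) := by
    intro g g' j hj hg i hi hij hij' h
    refine h.congr (hq i hi) fun v hv => hg v ?_
    rw [hc i hi] at hv
    rcases hv with rfl | rfl | rfl | rfl
    · exact hst i hi.le j hj
    · exact fun h => hij (hinj (Set.mem_Iic.2 hi.le) (Set.mem_Iic.2 hj) h)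
    · exact fun h => hij' (hinj (Set.mem_Iic.2 hi) (Set.mem_Iic.2 hj) h)
    · exact hst (i + 1) hi j hj
  -- From position `m`, where the new value is prescribed, the values are found quad by quad up to
  -- `n`, and afterwards backwards down to 0. Staying outside `C` is what keeps the next quad
  -- solvable.
  have hup : ∀ j, m + j ≤ n → ∃ g : V → L, Set.EqOn f g K ∧ g (t m) = y ∧
      (∀ i, m ≤ i → i ≤ m + j → g (t i) ∉ C) ∧
      ∀ i, m ≤ i → i < m + j → E.IsGenericAt g (q i) := by
    intro j
    induction j with
    | zero =>
      intro _
      refine ⟨Function.update f (t m) y, fun v hv => ?_, Function.update_self .., ?_, ?_⟩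
      · rw [Function.update_of_ne]
        rintro rfl
        exact ht m hm hv
      · intro i h1 h2
        obtain rfl : i = m := by omega
        rwa [Function.update_self]
      · intro i h1 h2
        omega
    | succ j ih =>
      intro hj
      obtain ⟨g, hg1, hg2, hg3, hg4⟩ := ih (by omega)
      have hi : m + j < n := by omega
      obtain ⟨c, hc1, hc2⟩ := exists_isGenericAt_update_notMem (E := E) (f := g)
        (hq _ hi) hC (t := t (m + j)) (t' := t (m + j + 1))
        (by rw [hc _ hi]; simp) (by rw [hc _ hi]; simp) (htt _ hi) (hr _ hi) (hl _ hi)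
        ((hf _ hi).congr (hg1.mono (by
          rintro v (rfl | rfl)
          exacts [hs _ hi.le, hs _ hi])))
        (by
          rintro v (rfl | rfl)
          · rw [← hg1 (hs _ hi.le)]; exact hfC _ (hs _ hi.le)
          · rw [← hg1 (hs _ hi)]; exact hfC _ (hs _ hi))
        (hg3 _ (by omega) le_rfl)
      refine ⟨Function.update g (t (m + j + 1)) c, fun v hv => ?_, ?_, ?_, ?_⟩
      · rw [Function.update_of_ne, hg1 hv]
        rintro rfl
        exact ht _ hi hv
      · rw [Function.update_of_ne, hg2]
        intro h
        have := hinj (Set.mem_Iic.2 hm) (Set.mem_Iic.2 hi) h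
        omega
      · intro i h1 h2
        by_cases h3 : i = m + j + 1
        · rw [h3, Function.update_self]; exact hc2
        · rw [Function.update_of_ne]
          · exact hg3 i h1 (by omega)
          · exact fun h => h3 (hinj (Set.mem_Iic.2 (by omega)) (Set.mem_Iic.2 hi) h)
      · intro i h1 h2
        by_cases h3 : i = m + j
        · rw [h3]; exact hc1
        · exact hcongr g _ (m + j + 1) hi (fun v hv => (Function.update_of_ne hv _ _).symm) i
            (by omega) (by omega) (by omega) (hg4 i h1 (by omega))
  have hdown : ∀ j, j ≤ m → ∃ g : V → L, Set.EqOn f g K ∧ g (t m) = y ∧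
      (∀ i, m ≤ i + j → i ≤ n → g (t i) ∉ C) ∧
      ∀ i, m ≤ i + j → i < n → E.IsGenericAt g (q i) := by
    intro j
    induction j with
    | zero =>
      intro _
      obtain ⟨g, hg1, hg2, hg3, hg4⟩ := hup (n - m) (by omega)
      exact ⟨g, hg1, hg2, fun i h1 h2 => hg3 i h1 (by omega), fun i h1 h2 => hg4 i h1 (by omega)⟩
    | succ j ih =>
      intro hj
      obtain ⟨g, hg1, hg2, hg3, hg4⟩ := ih (by omega)
      obtain ⟨p, hp⟩ : ∃ p, p + 1 + j = m := ⟨m - (j + 1), by omega⟩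
      have hi : p < n := by omega
      obtain ⟨c, hc1, hc2⟩ := exists_isGenericAt_update_notMem (E := E) (f := g)
        (hq _ hi) hC (t := t (p + 1)) (t' := t p)
        (by rw [hc _ hi]; simp) (by rw [hc _ hi]; simp) (htt _ hi).symm (hl _ hi) (hr _ hi)
        ((hf _ hi).congr (hg1.mono (by
          rintro v (rfl | rfl)
          exacts [hs _ hi.le, hs _ hi])))
        (by
          rintro v (rfl | rfl)
          · rw [← hg1 (hs _ hi.le)]; exact hfC _ (hs _ hi.le)
          · rw [← hg1 (hs _ hi)]; exact hfC _ (hs _ hi))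
        (hg3 _ (by omega) hi)
      refine ⟨Function.update g (t p) c, fun v hv => ?_, ?_, ?_, ?_⟩
      · rw [Function.update_of_ne, hg1 hv]
        rintro rfl
        exact ht _ hi.le hv
      · rw [Function.update_of_ne, hg2]
        intro h
        have := hinj (Set.mem_Iic.2 hm) (Set.mem_Iic.2 hi.le) h
        omega
      · intro i h1 h2
        by_cases h3 : i = p
        · rw [h3, Function.update_self]; exact hc2
        · rw [Function.update_of_ne]
          · exact hg3 i (by omega) h2
          · exact fun h => h3 (hinj (Set.mem_Iic.2 h2) (Set.mem_Iic.2 hi.le) h)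
      · intro i h1 h2
        by_cases h3 : i = p
        · rw [h3]; exact hc1
        · exact hcongr g _ p hi.le (fun v hv => (Function.update_of_ne hv _ _).symm) i
            h2 h3 (by omega) (hg4 i (by omega) h2)
  obtain ⟨g, hg1, hg2, hg3, hg4⟩ := hdown m le_rfl
  exact ⟨g, hg1, hg2, fun i hi => hg3 i (by omega) hi, fun i hi => hg4 i (by omega) hi⟩

/-- Along a strip, algebraic independence passes from one side to the other one. -/
lemma algebraicIndepOn_along {n : ℕ} {q : ℕ → D} {s t : ℕ → V} {K : Set V} {C : Set L}
    (hC : (AlgebraicIndependent.matroid k L).closure C = C)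
    (hq : ∀ i < n, q i ∉ G.hole)
    (hc : ∀ i < n, G.corners (q i) = {s i, t i, t (i + 1), s (i + 1)})
    (hs : ∀ i ≤ n, s i ∈ K) (hfC : ∀ v ∈ K, f v ∈ C)
    (hf : ∀ i < n, E.IsGenericAt f (q i)) {m : ℕ} (hm : m ≤ n) (hy : f (t m) ∉ C)
    (hS : AlgebraicIndepOn k f (s '' Set.Iic n))
    (hcard : (t '' Set.Iic n).encard ≤ (s '' Set.Iic n).encard) :
    AlgebraicIndepOn k f (t '' Set.Iic n) := by
  have hsC : f '' (s '' Set.Iic n) ⊆ C := by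
    rintro _ ⟨_, ⟨i, hi, rfl⟩, rfl⟩
    exact hfC _ (hs i hi)
  -- One value outside `C` enlarges the independent set on the near side by one.
  have h1 : AlgebraicIndepOn k f (insert (t m) (s '' Set.Iic n)) := by
    refine hS.insert_of_notMem_closure fun h => hy ?_
    rw [mem_valueMatroid_closure] at h
    rw [← hC]
    exact Matroid.closure_subset_closure _ hsC h
  have hnot : t m ∉ s '' Set.Iic n := fun h => hy (hsC ⟨_, h, rfl⟩)
  have hsub : insert (s 0) (t '' Set.Iic n) ⊆
      (valueMatroid k f).closure (insert (s 0) (t '' Set.Iic n)) :=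
    subset_valueMatroid_closure _
  -- From `s 0` and the far side, the relations give back the near side one vertex after another.
  have hcl : ∀ i ≤ n, s i ∈ (valueMatroid k f).closure (insert (s 0) (t '' Set.Iic n)) := by
    intro i
    induction i with
    | zero => exact fun _ => hsub (Set.mem_insert _ _)
    | succ i ih =>
      intro hi
      have h2 := (hf i hi).mem_closure (hq i hi) (y := s (i + 1)) (by rw [hc i hi]; simp)
      refine Matroid.closure_subset_closure_of_subset_closure ?_ h2
      rw [hc i hi]
      rintro v ⟨rfl | rfl | rfl | rfl, hv⟩
      · exact ih (by omega)
      · exact hsub (Or.inr ⟨i, Set.mem_Iic.2 (by omega), rfl⟩)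
      · exact hsub (Or.inr ⟨i + 1, hi, rfl⟩)
      · exact absurd rfl hv
  -- The far side with `s 0` spans this enlarged independent set and is no larger, so it is
  -- independent too; then `s 0` is dropped.
  refine AlgebraicIndepOn.mono (h1.of_subset_closure (J := insert (s 0) (t '' Set.Iic n))
    (((Set.finite_Iic n).image t).insert _) ?_ ?_) (Set.subset_insert _ _)
  · rintro v (rfl | ⟨i, hi, rfl⟩)
    · exact hsub (Or.inr ⟨m, hm, rfl⟩)
    · exact hcl i hi
  · rw [Set.encard_insert_of_notMem hnot]
    exact (Set.encard_insert_le _ _).trans (add_le_add_left hcard 1)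

open Classical in
/-- For algebraically independent initial values there is a generic solution. -/
theorem exists_isGenericOn [Finite V] [Finite D] (E : G.Relations k) (hA : G.IsArrangement)
    {J W : Set V} (hJ : G.Run J W) {a : V → L} (ha : AlgebraicIndepOn k a J) :
    ∃ f : V → L, Set.EqOn a f J ∧ E.IsGenericOn f W := by
  obtain ⟨n, hn⟩ : ∃ n, n = W.ncard := ⟨_, rfl⟩
  induction n using Nat.strong_induction_on generalizing J W a with
  | _ n ih =>
  subst hn
  cases hJ with
  | start x =>
    refine ⟨a, fun _ _ => rfl, fun d _ h => ?_⟩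
    have h0 : G.src d = x := h (by simp [corners])
    have h1 : G.src (G.next d) = x := h (by simp [corners])
    rw [src_next_eq, ← h0] at h1
    exact absurd h1.symm (hA.src_ne_tgt d)
  | @step I K d hI hd =>
    change AlgebraicIndepOn k a (insert (G.tgt d) I) at ha
    change ∃ f : V → L, Set.EqOn a f (insert (G.tgt d) I) ∧
      E.IsGenericOn f (G.closure (insert (G.tgt d) K))
    have hK := hI.isConvex hA
    have hW := hA.isConvex_closure_insert hK hd.1
    have hKW : K ⊆ G.closure (insert (G.tgt d) K) :=
      (Set.subset_insert _ _).trans (QuadGraph.subset_closure _)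
    have hdW : G.tgt d ∈ G.closure (insert (G.tgt d) K) :=
      QuadGraph.subset_closure _ (Or.inl rfl)
    have hdI : G.tgt d ∉ I := fun h => hd.2.1 (hI.subset h)
    have hlt1 : K.ncard < (G.closure (insert (G.tgt d) K)).ncard :=
      Set.ncard_lt_ncard ⟨hKW, fun h => hd.2.1 (h hdW)⟩
    have hlt2 : (G.closure (insert (G.tgt d) K) \ K).ncard <
        (G.closure (insert (G.tgt d) K)).ncard :=
      Set.ncard_lt_ncard ⟨Set.sdiff_subset, fun h => (h (hKW hd.1)).2 hd.1⟩
    -- First use of induction, on the near part `K`; the second one is on `W \ K`, with initial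
    -- values taken from the far side of the new strip.
    obtain ⟨f₀, hf₀, hg₀⟩ := ih _ hlt1 hI (ha.mono (Set.subset_insert _ _)) rfl
    have hI₀ : AlgebraicIndepOn k f₀ I := (ha.mono (Set.subset_insert _ _)).congr hf₀
    obtain ⟨b, n, hb⟩ := hW.exists_isStripIn hA (hKW hd.1) hdW
    obtain ⟨m, hm, hmd⟩ := hb.exists_eq d (Aligned.refl d) (hKW hd.1) hdW
    have hr : G.Reach n b (G.across^[n] b) := ⟨hb.notMem_hole, rfl⟩
    obtain ⟨K₁, hK₁, hg₁⟩ := hr.exists_run_left hA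
    obtain ⟨K₂, hK₂, hg₂⟩ := hr.exists_run_right hA
    have hK₁K : K₁ ⊆ K := hK₁.subset_of_quadClosed hK.quadClosed (by
      rintro _ ⟨i, hi, rfl⟩
      exact hK.src_mem_of_isStripIn hA hd hb hi)
    -- The near side of the strip consists of the initial vertices of a run inside `K`.
    have hS := hg₀.algebraicIndepOn_of_subset hA hI hI₀ hK₁ hK₁K
    let C : Set L := (AlgebraicIndependent.matroid k L).closure (f₀ '' K)
    have hC : (AlgebraicIndependent.matroid k L).closure C = C := Matroid.closure_closure _ _
    have hfC : ∀ v ∈ K, f₀ v ∈ C := fun v hv =>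
      Matroid.subset_closure _ _ (Set.subset_univ _) ⟨v, hv, rfl⟩
    have hcor : ∀ i < n, G.corners (G.across^[i] b) = {G.src (G.across^[i] b),
        G.tgt (G.across^[i] b), G.tgt (G.across^[i + 1] b), G.src (G.across^[i + 1] b)} := by
      intro i _
      rw [iterate_across_succ, tgt_across, src_across, ← src_next_eq]
      rfl
    -- All values on `K` are algebraic over those on `I`, of which the new initial value is
    -- independent.
    have hy : a (G.tgt d) ∉ C := by
      intro h
      have h1 : f₀ '' K ⊆ (AlgebraicIndependent.matroid k L).closure (f₀ '' I) := by
        rintro _ ⟨v, hv, rfl⟩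
        exact mem_valueMatroid_closure.1 (hg₀.subset_closure hA hI hv)
      have h2 := Matroid.closure_subset_closure_of_subset_closure h1 h
      rw [← hf₀.image_eq, ← mem_valueMatroid_closure] at h2
      have h3 : (valueMatroid k a).Indep (insert (G.tgt d) I) := valueMatroid_indep_iff.2 ha
      have h4 := valueMatroid_indep_iff.2 (ha.mono (Set.subset_insert _ _))
      rw [h4.insert_indep_iff] at h3
      rcases h3 with h3 | h3
      · exact h3.2 h2
      · exact hdI h3
    obtain ⟨f, hf1, hf2, hf3, hf4⟩ := exists_isGenericAt_along (E := E) (f := f₀) hC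
      hb.notMem_hole hcor (fun i hi => hK.src_mem_of_isStripIn hA hd hb hi)
      (fun i hi => hK.tgt_notMem_of_isStripIn hA hd hb hi) (hr.tgt_injOn hA) hfC
      (fun i hi => hS.mono (by
        rintro v (rfl | rfl)
        exacts [⟨i, Set.mem_Iic.2 hi.le, rfl⟩, ⟨i + 1, Set.mem_Iic.2 hi, rfl⟩])) hm hy
    have hT : AlgebraicIndepOn k f ((fun i => G.tgt (G.across^[i] b)) '' Set.Iic n) := by
      refine algebraicIndepOn_along (E := E) hC hb.notMem_hole hcor
        (fun i hi => hK.src_mem_of_isStripIn hA hd hb hi)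
        (fun v hv => hf1 hv ▸ hfC v hv) hf4 hm (hf3 m hm) (hS.congr (hf1.mono ?_)) ?_
      · rintro _ ⟨i, hi, rfl⟩
        exact hK.src_mem_of_isStripIn hA hd hb hi
      · rw [hK₁.encard_eq hA, hK₂.encard_eq hA, hg₁, hg₂]
    obtain ⟨f₁, hf₁, hgen₁⟩ := ih _ hlt2 (hK.run_sdiff hA hd hb) hT rfl
    -- The extension `f` is under control only on `K` and along the strip; beyond the strip `f₁` is
    -- used, which agrees with `f` on the far side of the strip.
    let F : V → L := fun v => if v ∈ K then f v else f₁ v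
    have hFK : Set.EqOn f₀ F K := fun v hv => (hf1 hv).trans (if_pos hv).symm
    have hFK' : Set.EqOn f₁ F (G.closure (insert (G.tgt d) K) \ K) := fun v hv =>
      (if_neg hv.2).symm
    have hFT : ∀ i ≤ n, f (G.tgt (G.across^[i] b)) = F (G.tgt (G.across^[i] b)) := fun i hi =>
      (hf₁ ⟨i, hi, rfl⟩).trans (if_neg (hK.tgt_notMem_of_isStripIn hA hd hb hi)).symm
    have hFS : ∀ i ≤ n, f (G.src (G.across^[i] b)) = F (G.src (G.across^[i] b)) := fun i hi =>
      (if_pos (hK.src_mem_of_isStripIn hA hd hb hi)).symm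
    refine ⟨F, ?_, fun q hq hqW => ?_⟩
    · rintro v (rfl | hv)
      · have := hFT m hm
        rw [hf2, hmd] at this
        exact this
      · exact (hf₀ hv).trans (hFK (hI.subset hv))
    · have hgen : ∀ i < n, E.IsGenericAt F (G.across^[i] b) := by
        intro i hi
        refine (hf4 i hi).congr (hb.notMem_hole i hi) ?_
        rw [hcor i hi]
        rintro v (rfl | rfl | rfl | rfl)
        exacts [hFS i hi.le, hFT i hi.le, hFT (i + 1) hi, hFS (i + 1) hi]
      have hq1 := next_notMem hq
      have hq2 := next_notMem hq1
      rcases hK.corners_cases hA hd hb hq hqW with h | h | ⟨i, hi, h | h | h | h⟩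
      · exact (hg₀ q hq h).congr hq (hFK.mono h)
      · exact (hgen₁ q hq h).congr hq (hFK'.mono h)
      · exact h ▸ hgen i hi
      · exact (h ▸ hgen i hi : E.IsGenericAt F (G.next q)).of_next hq
      · exact ((h ▸ hgen i hi : E.IsGenericAt F (G.next (G.next q))).of_next hq1).of_next hq
      · exact (((h ▸ hgen i hi : E.IsGenericAt F (G.next (G.next (G.next q)))).of_next
          hq2).of_next hq1).of_next hq

end Relations

end QuadGraph

namespace QuadGraph

variable {V : Type u} {D : Type v} {G : QuadGraph V D} {k : Type w} [Field k]

/-! ### Well-posedness -/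

open MvPolynomial

/-- Finitely many rational functions can be evaluated at the points outside the zero set of a
non-zero polynomial, and this preserves polynomial relations. -/
lemma exists_specialization {ι κ : Type*} [Finite κ] (f : κ → FractionRing (MvPolynomial ι k)) :
    ∃ P : MvPolynomial ι k, P ≠ 0 ∧ ∀ a : ι → k, eval a P ≠ 0 → ∃ g : κ → k,
      (∀ j x, f j = algebraMap _ _ x → g j = eval a x) ∧
      ∀ Q : MvPolynomial κ k, aeval f Q = 0 → eval g Q = 0 := by
  -- `P` is a common denominator. The given rational functions lie in the localization at `P`, to
  -- which evaluation at `a` extends when `P` does not vanish at `a`.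
  obtain ⟨b, hb⟩ := IsLocalization.exist_integer_multiples_of_finite
    (nonZeroDivisors (MvPolynomial ι k)) f
  obtain ⟨P, hP⟩ := b
  have hP0 : P ≠ 0 := nonZeroDivisors.ne_zero hP
  refine ⟨P, hP0, fun a ha => ?_⟩
  let R := MvPolynomial ι k
  let S := Localization.Away P
  have hinj : Function.Injective (algebraMap R (FractionRing R)) := IsFractionRing.injective _ _
  have hP1 : algebraMap R (FractionRing R) P ≠ 0 := fun h =>
    hP0 (hinj (h.trans (map_zero _).symm))
  let ψ : S →+* FractionRing R := IsLocalization.Away.lift P (g := algebraMap R (FractionRing R))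
    hP1.isUnit
  let φ : S →+* k := IsLocalization.Away.lift P (g := eval a) ha.isUnit
  have hψ : ∀ x, ψ (algebraMap R S x) = algebraMap R (FractionRing R) x := fun x =>
    IsLocalization.Away.lift_eq P _ x
  have hφ : ∀ x, φ (algebraMap R S x) = eval a x := fun x => IsLocalization.Away.lift_eq P _ x
  -- Polynomial relations are verified in the fraction field but specialized from the localization,
  -- so the latter has to embed in the former.
  have hψinj : Function.Injective ψ := by
    rw [injective_iff_map_eq_zero]
    intro s hs
    obtain ⟨n, r, hr⟩ := IsLocalization.Away.surj P s
    have h1 := congrArg ψ hr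
    rw [map_mul, hs, zero_mul, hψ] at h1
    rw [hinj (h1.symm.trans (map_zero _).symm), map_zero] at hr
    have hu : IsUnit (algebraMap R S P ^ n) := (IsLocalization.Away.algebraMap_isUnit P).pow n
    exact hu.mul_left_eq_zero.1 hr
  have hsurj : ∀ j, ∃ s, ψ s = f j := by
    intro j
    obtain ⟨N, hN⟩ := hb j
    refine ⟨algebraMap R S N * IsLocalization.Away.invSelf P, ?_⟩
    have h1 := congrArg ψ (IsLocalization.Away.mul_invSelf (S := S) P)
    rw [map_mul, map_one, hψ] at h1
    rw [map_mul, hψ, hN]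
    change (P • f j) * _ = _
    rw [Algebra.smul_def]
    linear_combination f j * h1
  choose s hs using hsurj
  refine ⟨fun j => φ (s j), fun j x hx => ?_, fun Q hQ => ?_⟩
  · rw [← hφ]
    exact congrArg φ (hψinj (by rw [hs, hψ, hx]))
  · have h1 : ψ (eval₂ ((algebraMap R S).comp C) s Q) = 0 := by
      rw [eval₂_comp_left, ← hQ, aeval_def]
      congr 1
      · ext x
        rw [RingHom.comp_apply, RingHom.comp_apply, hψ, IsScalarTower.algebraMap_apply k R]
        rfl
      · exact funext hs
    have h2 := congrArg φ (hψinj (h1.trans (map_zero ψ).symm))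
    rw [eval₂_comp_left, map_zero] at h2
    rw [← h2, eval, coe_eval₂Hom]
    congr 1
    ext x
    rw [RingHom.comp_apply, RingHom.comp_apply, hφ, eval_C, RingHom.id_apply]

/-- The initial values are taken to be independent variables over `k`. A generic solution in
rational functions of these is specialized for existence; uniqueness follows by propagating equality
from `I` with the quad rule. -/
theorem Run.wellPosed [Finite V] [Finite D] (hA : G.IsArrangement) {I : Set V}
    (hI : G.Run I Set.univ) (E : G.Relations k) : E.WellPosed I := by
  classical
  let L := FractionRing (MvPolynomial I k)
  -- Only the values on `I` matter; 0 is a filler elsewhere.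
  let a₀ : V → L := fun v =>
    if h : v ∈ I then algebraMap (MvPolynomial I k) L (X (⟨v, h⟩ : I)) else 0
  have ha₀ : ∀ i : I, a₀ i = algebraMap (MvPolynomial I k) L (X i) := fun i => dif_pos i.2
  have hind : AlgebraicIndepOn k a₀ I := by
    have h1 := (algebraicIndependent_X I k).map' (f := IsScalarTower.toAlgHom k
      (MvPolynomial I k) L) (IsFractionRing.injective _ _)
    have h2 : (fun i : I => a₀ i) = (IsScalarTower.toAlgHom k (MvPolynomial I k) L) ∘ X :=
      funext ha₀
    unfold AlgebraicIndepOn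
    rw [h2]
    exact h1
  obtain ⟨f, hf, hgen⟩ := Relations.exists_isGenericOn E hA hI hind
  have hAB : ∀ d, d ∉ G.hole → ∃ A ∈ supported k
      (G.corners d \ {G.src (G.next (G.next (G.next d)))}), ∃ B ∈ supported k
      (G.corners d \ {G.src (G.next (G.next (G.next d)))}), A ≠ 0 ∧
      E.rel d = X (G.src (G.next (G.next (G.next d)))) * A + B := by
    intro d hd
    have h := exists_eq_X_mul_add_of_degreeOf_eq_one
      (E.degreeOf_rel d hd (G.src (G.next (G.next (G.next d)))) (by simp [corners]))
    rwa [E.vars_rel d hd] at h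
  choose! A hAs B hBs hA0 hrel using hAB
  have hA1 : ∀ d, d ∉ G.hole → aeval f (A d) ≠ 0 := fun d hd h =>
    hA0 d hd (((hgen d hd (Set.subset_univ _)).2 _ (by simp [corners])).eq_zero (hAs d hd) h)
  -- The inverses of the coefficients of the fourth value are specialized along with the solution.
  -- The relation that a coefficient times its inverse is 1 then survives, so these coefficients
  -- stay nonzero.
  obtain ⟨P, hP0, hP⟩ := exists_specialization
    (Sum.elim f fun d : D => (aeval f (A d))⁻¹)
  refine ⟨P, hP0, fun a ha => ?_⟩
  obtain ⟨g, hg1, hg2⟩ := hP a ha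
  have hren : ∀ Q : MvPolynomial V k, eval (g ∘ Sum.inl) Q = eval g (rename Sum.inl Q) :=
    fun Q => (eval_rename _ _ _).symm
  have hren' : ∀ Q : MvPolynomial V k,
      aeval (Sum.elim f fun d : D => (aeval f (A d))⁻¹) (rename Sum.inl Q) = aeval f Q := by
    intro Q
    rw [aeval_rename, Sum.elim_comp_inl]
  have hgA : ∀ d, d ∉ G.hole → eval (g ∘ Sum.inl) (A d) ≠ 0 := by
    intro d hd h
    have h1 := hg2 (rename Sum.inl (A d) * X (Sum.inr d) - 1) (by
      rw [map_sub, map_mul, hren', aeval_X, Sum.elim_inr, mul_inv_cancel₀ (hA1 d hd), map_one,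
        sub_self])
    rw [map_sub, map_mul, ← hren, h, zero_mul, map_one, zero_sub, neg_eq_zero] at h1
    exact one_ne_zero h1
  have hsol : E.IsSolution (g ∘ Sum.inl) := fun d hd => by
    rw [hren]
    exact hg2 _ ((hren' _).trans (hgen d hd (Set.subset_univ _)).1)
  have hinit : ∀ i : I, (g ∘ Sum.inl) (i : V) = a i := by
    intro i
    have h1 := hg1 (Sum.inl i) (X i) ((hf i.2).symm.trans (ha₀ i))
    rwa [eval_X] at h1
  refine ⟨g ∘ Sum.inl, ⟨hsol, hinit⟩, ?_⟩
  rintro f' ⟨hf', hi'⟩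
  -- Where two solutions agree at three vertices of a quad, both fourth values solve the same affine
  -- equation with nonzero leading coefficient.
  have hclosed : G.QuadClosed {v | f' v = (g ∘ Sum.inl) v} := by
    intro d hd h0 h1 h2
    have heq : Set.EqOn f' (g ∘ Sum.inl)
        (G.corners d \ {G.src (G.next (G.next (G.next d)))}) := by
      rintro v ⟨rfl | rfl | rfl | rfl, hv⟩
      exacts [h0, h1, h2, absurd rfl hv]
    have eA := aeval_eq_of_eqOn heq (hAs d hd)
    have eB := aeval_eq_of_eqOn heq (hBs d hd)
    rw [aeval_eq_eval, aeval_eq_eval] at eA eB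
    have e1 := hf' d hd
    have e2 := hsol d hd
    rw [hrel d hd, map_add, map_mul, eval_X] at e1 e2
    change f' _ = (g ∘ Sum.inl) _
    refine mul_right_cancel₀ (hgA d hd) ?_
    have eA' : eval f' (A d) = eval (g ∘ Sum.inl) (A d) := eA
    have eB' : eval f' (B d) = eval (g ∘ Sum.inl) (B d) := eB
    rw [eA', eB'] at e1
    linear_combination e1 - e2
  exact funext fun v => hI.subset_of_quadClosed hclosed
    (fun i hi => (hi' ⟨i, hi⟩).trans (hinit ⟨i, hi⟩).symm) (Set.mem_univ v)

end QuadGraph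

theorem mainTheorem2 {V : Type u} {D : Type v} {k : Type w} [Field k] [Infinite k]
    (G : QuadGraph V D) (hG : G.SimplyConnected) (hR : Nonempty G.RhombicEmbedding) :
    -- no strip crosses itself, no strip is closed, two distinct strips cross at most once
    (∀ S : G.Strip, G.crossings S S = ∅) ∧
    (∀ S : G.Strip, ¬ G.IsClosedStrip S) ∧
    (∀ S T : G.Strip, S ≠ T → (G.crossings S T).Subsingleton) ∧
    -- no entangled set of curves occurs at any stage of the construction
    (∀ I K : Set V, G.Run I K → ∀ A : Set G.Strip, ¬ G.IsEntangled K A) ∧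
    -- on a finite graph with `s` strips, the construction can be continued, whatever the choices
    -- made, until there are `s + 1` initial values, and then the problem is well-posed
    (Finite V → Finite D → ∀ I K : Set V, G.Run I K →
      I.ncard ≤ Nat.card G.Strip + 1 ∧
      (I.ncard < Nat.card G.Strip + 1 → ∃ d, G.IsOrangeEnclosing K d) ∧
      (I.ncard = Nat.card G.Strip + 1 →
        K = Set.univ ∧ ∀ E : G.Relations k, E.WellPosed I)) := by
  obtain ⟨ρ⟩ := hR
  have hA := ρ.isArrangement hG
  refine ⟨hA.crossings_self, ρ.not_isClosedStrip, fun S T _ => hA.crossings_subsingleton S T,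
    fun I K h A => (h.isConvex hA).not_isEntangled hA A, fun _ _ I K h => ?_⟩
  refine ⟨h.ncard_le hA, h.exists_isOrangeEnclosing_of_ncard_lt hA, fun hI => ?_⟩
  obtain rfl := h.eq_univ hA hI
  exact ⟨rfl, h.wellPosed hA⟩
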